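/- Let $k$ be an algebraically closed field of characteristic different from $2$, let $K$ be a hyperelliptic function field of genus $3$ over $k$ (a function field of one variable of genus $3$ that is a quadratic extension of a rational function field $k(t)$), and let $k\subset F\subset K$ be an elliptic subfield (a function field of genus $1$) with $[K:F]=2$. Then there are $X,Y\in K$ and $a,b,c\in k$ such that the following hold. (i) $K=k(X,Y)$, $\;Y^2=X^8+aX^6+bX^4+cX^2+1$, and $\Delta\neq 0$, where $$\begin{aligned}\Delta=256\,(&-256+80ab^2c-18a^3bc-18abc^3-a^2b^2c^2+6a^2c^2-144bc^2+4a^3c^3\\&+4a^2b^3+4b^3c^2+128b^2-144a^2b+192ac-16b^4+27c^4+27a^4)^2 .\end{aligned}$$ (ii) $F=k(U,V)$ with $U=X^2$, $V=Y$, and $V^2=U^4+aU^3+bU^2+cU+1$. (iii) The field $L=k(x,y)$ with $x=X^2$, $y=YX$ is a subfield of $K$ of genus $2$ with $[K:L]=2$, and $y^2=x(x^4+ax^3+bx^2+cx+1)$. It is complementary to $F$: if $\zeta_0$ is the hyperelliptic involution of $K$ (the involution whose fixed field is a rational function field) and $\zeta_1$ is the involution of $K/k$ with fixed field $F$, then $L$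 is the fixed field of $\zeta_0\zeta_1$. -/

import Mathlib

open scoped IntermediateField

namespace HypSplit

section
variable (k K : Type*) [Field k] [Field K] [Algebra k K]

/-- `K` is an algebraic function field of one variable over `k`: a finitely generated field
extension of transcendence degree one, i.e. a finite extension of some `k(t)` with `t`
transcendental over `k`. -/
def IsFunctionField : Prop :=
  ∃ t : K, Transcendental k t ∧ FiniteDimensional k⟮t⟯ K

/-- The `k`-space of regular (holomorphic, "first kind") differentials of `K / k`: the Kähler
differentials `ω` that are regular at every place, i.e. for each valuation ring `O` of `K`
containing `k`, `ω` is an `O`-linear combination of differentials `da` with `a ∈ O`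
(equivalently, `ω` lies in the image of `Ω[O⁄k]`).  The trivial valuation ring `O = K` imposes
no condition. -/
noncomputable def regularDifferentials : Submodule k (Ω[K⁄k]) where
  carrier := {ω | ∀ O : ValuationSubring K, (∀ c : k, algebraMap k K c ∈ O) →
    ω ∈ Submodule.span O (Set.range fun a : O => KaehlerDifferential.D k K (a : K))}
  zero_mem' := fun _ _ => Submodule.zero_mem _
  add_mem' := fun h₁ h₂ O hO => Submodule.add_mem _ (h₁ O hO) (h₂ O hO)
  smul_mem' := fun c ω h O hO => by
    have h' := Submodule.smul_mem _ (⟨algebraMap k K c, hO c⟩ : O) (h O hO)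
    have e : (⟨algebraMap k K c, hO c⟩ : O) • ω = c • ω := by
      change (algebraMap k K c) • ω = c • ω
      exact algebraMap_smul K c ω
    rwa [e] at h'

/-- The genus of a function field `K` over an algebraically closed field `k`: the dimension of
its space of regular differentials. -/
noncomputable def genus : ℕ := Module.finrank k (regularDifferentials k K)

/-- A function field of genus `g`. -/
def IsFunctionFieldOfGenus (g : ℕ) : Prop :=
  IsFunctionField k K ∧ genus k K = g

/-- An elliptic function field: a function field of genus one (over an algebraically closed field
every function field has a rational place). -/
def IsElliptic : Prop := IsFunctionFieldOfGenus k K 1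

/-- A hyperelliptic function field of genus `g`: the genus is `g ≥ 2`, and `K` is a quadratic
extension of a rational function field `k(x)`. -/
def IsHyperelliptic (g : ℕ) : Prop :=
  IsFunctionFieldOfGenus k K g ∧ 2 ≤ g ∧
    ∃ x : K, Transcendental k x ∧ Module.finrank k⟮x⟯ K = 2

end

section
variable {k K : Type*} [Field k] [Field K] [Algebra k K]

/-- `ζ` is an involution of `K / k` whose field of invariants is `M`. -/
def IsInvolutionFixing (ζ : K ≃ₐ[k] K) (M : IntermediateField k K) : Prop :=
  orderOf ζ = 2 ∧ ∀ z : K, z ∈ M ↔ ζ z = z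

/-- `ζ` is a hyperelliptic involution of `K / k`: an involution whose field of invariants is a
rational function field. -/
def IsHyperellipticInvolution (ζ : K ≃ₐ[k] K) : Prop :=
  ∃ x : K, Transcendental k x ∧ IsInvolutionFixing ζ k⟮x⟯

/-- The subfields `F` and `L` of `K` are complementary: they are the fixed fields of two
involutions `ζ₁` and `ζ₂ = ζ₀ ζ₁`, where `ζ₀` is the hyperelliptic involution. -/
def IsComplementary (F L : IntermediateField k K) : Prop :=
  ∃ ζ₀ ζ₁ : K ≃ₐ[k] K, IsHyperellipticInvolution ζ₀ ∧
    IsInvolutionFixing ζ₁ F ∧ IsInvolutionFixing (ζ₀ * ζ₁) L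

end

/-- The discriminant of `X⁸ + aX⁶ + bX⁴ + cX² + 1`. -/
def Δ {k : Type*} [Field k] (a b c : k) : k :=
  256 * (-256 + 80 * b ^ 2 * a * c - 18 * b * a ^ 3 * c - 18 * a * c ^ 3 * b
    - b ^ 2 * a ^ 2 * c ^ 2 + 6 * a ^ 2 * c ^ 2 - 144 * c ^ 2 * b + 4 * a ^ 3 * c ^ 3
    + 4 * b ^ 3 * a ^ 2 + 4 * b ^ 3 * c ^ 2 + 128 * b ^ 2 - 144 * b * a ^ 2 + 192 * a * c
    - 16 * b ^ 4 + 27 * c ^ 4 + 27 * a ^ 4) ^ 2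

end HypSplit

/-!
A function field `K = k(x, y)`, `y² = f(x)`, with `f` squarefree of degree `2 g + 1` or `2 g + 2`,
has as regular differentials exactly the `p(x) dx / y` with `deg p < g`
(`IsSqrtModel.mem_regularDifferentials_iff`), so its genus is `g`. These differentials are regular
where `x` is, because `u f + v f' = 1` gives `dx / y = u(x) y dx + 2 v(x) dy`; at the other places
one replaces `x` by `1 / x`. Conversely, write a regular differential as `(A / y + B) dx` with
`A, B ∈ k(x)`. The two conjugate embeddings of `K` into `k((π))` with `x ↦ π²` carry it to
differentials of `k((π))` without pole, so neither `A` nor `B` has a pole at `x = 0`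
(`IsSqrtModel.regularAtZero_of_mem_regularDifferentials`). Moving the other points of the
projective line to `0` shows that `A` and `B` are polynomials, that `B = 0`, and bounds `deg A`.

Now let `K` be of genus three, with quadratic model `(x, y, f)`, and let `ζ₁` be the involution
with field of invariants `F`. Then `(ζ₁ x, ζ₁ y, f)` is a model as well. Expressing its regular
differentials through those of the first model shows that `ζ₁ x` is a fractional linear function of
`x` (`IsSqrtModel.exists_moebius`). It is not `x` itself, since otherwise `F = k(x)` would have
genus zero, so some generator of `k(x)` is negated by `ζ₁` (`exists_negated_generator`). Taking it
for `x`, the comparison of `dx / y` with its image shows that `f` is even and `ζ₁ y = ± y`, and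
rescaling gives `y² = x⁸ + a x⁶ + b x⁴ + c x² + 1` (`IsSqrtModel.exists_normal_form`). If
`ζ₁ y = -y`, then `F = k(x², x y)` is the function field of the quintic
`Y² = X (X⁴ + a X³ + b X² + c X + 1)`, of genus two. Hence `ζ₁ y = y` and `F = k(x², y)`, while
`k(x², x y)` is the field of invariants of `ζ₀ ζ₁`.
-/

open scoped IntermediateField

namespace HypSplit
open Polynomial LaurentSeries

/-! ### Square roots of power series -/

section PowerSeriesSqrt
variable {k : Type*} [Field k]

/-- The coefficients of a square root of the power series with coefficients `f`, where `s₀` is a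
square root of `f 0`. -/
noncomputable def sqrtCoeff (f : ℕ → k) (s₀ : k) : ℕ → k
  | 0 => s₀
  | n + 1 => (f (n + 1) - ∑ i : Fin n, sqrtCoeff f s₀ (i + 1) * sqrtCoeff f s₀ (n - i)) / (2 * s₀)
  termination_by n => n
  decreasing_by all_goals omega

theorem exists_powerSeries_sq_eq [IsAlgClosed k] (h2 : (2 : k) ≠ 0) (f : PowerSeries k)
    (hf : PowerSeries.constantCoeff f ≠ 0) : ∃ s : PowerSeries k, s ^ 2 = f := by
  obtain ⟨s₀, hs₀⟩ := IsAlgClosed.exists_pow_nat_eq (PowerSeries.constantCoeff f) two_pos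
  have h0 : s₀ ≠ 0 := by
    rintro rfl
    exact hf (by rw [← hs₀]; simp)
  let c := sqrtCoeff (fun n => PowerSeries.coeff n f) s₀
  refine ⟨PowerSeries.mk c, ?_⟩
  ext n
  rw [pow_two, PowerSeries.coeff_mul, Finset.Nat.sum_antidiagonal_eq_sum_range_succ_mk]
  simp only [PowerSeries.coeff_mk]
  have c0 : c 0 = s₀ := by simp only [c, sqrtCoeff]
  cases n with
  | zero => simp [c0, ← pow_two, hs₀]
  | succ n =>
    have hc : c (n + 1) * (2 * s₀) =
        PowerSeries.coeff (n + 1) f - ∑ i ∈ Finset.range n, c (i + 1) * c (n - i) := by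
      rw [Finset.sum_range (fun i => c (i + 1) * c (n - i))]
      simp only [c]
      rw [sqrtCoeff, div_mul_cancel₀ _ (mul_ne_zero h2 h0)]
    rw [Finset.sum_range_succ, Finset.sum_range_succ']
    simp only [Nat.sub_self, Nat.sub_zero, c0, Nat.add_sub_add_right]
    linear_combination hc

end PowerSeriesSqrt

/-! ### Differentials under an embedding into Laurent series -/

section Euler
variable (k : Type*) [Field k]

/-- The Euler derivation `π · d/dπ` of the field of Laurent series in `π`. It maps power series
to power series without constant term. -/
noncomputable def eulerDeriv : k⸨X⸩ →+ k⸨X⸩ where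
  toFun z :=
    { coeff := fun n => (n : k) * z.coeff n
      isPWO_support' := z.isPWO_support.mono fun n hn h => hn (by simp [h]) }
  map_zero' := by ext n; simp
  map_add' z w := by ext n; simp [mul_add]

@[simp]
theorem coeff_eulerDeriv (z : k⸨X⸩) (n : ℤ) :
    (eulerDeriv k z).coeff n = (n : k) * z.coeff n := rfl

theorem eulerDeriv_mul (z w : k⸨X⸩) :
    eulerDeriv k (z * w) = z * eulerDeriv k w + w * eulerDeriv k z := by
  ext n
  rw [coeff_eulerDeriv, HahnSeries.coeff_add, HahnSeries.coeff_mul, mul_comm w,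
    HahnSeries.coeff_mul_right' w.isPWO_support (fun n hn h => hn (by simp [h])),
    HahnSeries.coeff_mul_left' z.isPWO_support (fun n hn h => hn (by simp [h])),
    ← Finset.sum_add_distrib, Finset.mul_sum]
  refine Finset.sum_congr rfl fun ij hij => ?_
  rw [Finset.mem_antidiagonal] at hij
  rw [← hij.2.2, coeff_eulerDeriv, coeff_eulerDeriv]
  push_cast
  ring

theorem eulerDeriv_C (c : k) : eulerDeriv k (HahnSeries.C c) = 0 := by
  ext n
  rcases eq_or_ne n 0 with rfl | h
  · simp
  · simp [HahnSeries.C, HahnSeries.coeff_single_of_ne h]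

theorem one_le_orderTop_eulerDeriv {z : k⸨X⸩} (hz : 0 ≤ z.orderTop) :
    1 ≤ (eulerDeriv k z).orderTop := by
  refine HahnSeries.le_orderTop_iff_forall.2 fun n hn => ?_
  rw [coeff_eulerDeriv]
  have hn' : n < 1 := by exact_mod_cast hn
  rcases (Int.lt_add_one_iff.1 hn' : n ≤ 0).eq_or_lt with rfl | h
  · simp
  · rw [HahnSeries.coeff_eq_zero_of_lt_orderTop (lt_of_lt_of_le (by exact_mod_cast h) hz), mul_zero]

variable {k} {K : Type*} [Field K] [Algebra k K]

/-- An embedding `φ : K → k((π))` over `k` induces a `φ`-semilinear map on differentials, sending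
`da` to `π · d(φ a)/dπ`. -/
theorem exists_semilinear_of_embedding (φ : K →+* k⸨X⸩)
    (hφ : ∀ c : k, φ (algebraMap k K c) = HahnSeries.C c) :
    ∃ T : Ω[K⁄k] →+ k⸨X⸩, (∀ a ω, T (a • ω) = φ a * T ω) ∧
      ∀ a, T (KaehlerDifferential.D k K a) = eulerDeriv k (φ a) := by
  let : Module K k⸨X⸩ := Module.compHom _ φ
  have hsm : ∀ (a : K) (z : k⸨X⸩), a • z = φ a * z := fun _ _ => rfl
  have hk : ∀ (c : k) (z : k⸨X⸩), c • z = HahnSeries.C c * z := fun c z => by simp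
  have : IsScalarTower k K k⸨X⸩ := ⟨fun c a z => by
    rw [hsm, hsm, hk, Algebra.smul_def, map_mul, hφ, mul_assoc]⟩
  let d : Derivation k K k⸨X⸩ := Derivation.mk'
    { toFun := fun a => eulerDeriv k (φ a)
      map_add' := fun a b => by simp
      map_smul' := fun c a => by
        rw [Algebra.smul_def, map_mul, hφ, eulerDeriv_mul, eulerDeriv_C, mul_zero, add_zero,
          RingHom.id_apply, hk] } fun a b => by
      simp [hsm, eulerDeriv_mul]
  refine ⟨d.liftKaehlerDifferential.toAddMonoidHom, fun a ω => ?_, fun a => ?_⟩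
  · exact d.liftKaehlerDifferential.map_smul a ω
  · exact d.liftKaehlerDifferential_comp_D a

/-- The valuation ring of `K` cut out by an embedding of `K` into `k((π))`: the preimage of
`k[[π]]`. -/
noncomputable def placeOfEmbedding (φ : K →+* k⸨X⸩) : ValuationSubring K where
  carrier := {z | 0 ≤ (φ z).orderTop}
  mul_mem' {a b} ha hb := by
    simp only [Set.mem_ofPred_eq, map_mul, HahnSeries.orderTop_mul] at *
    exact add_nonneg ha hb
  one_mem' := by simp
  add_mem' {a b} ha hb := by
    simp only [Set.mem_ofPred_eq, map_add] at *
    exact (le_min ha hb).trans HahnSeries.min_orderTop_le_orderTop_add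
  zero_mem' := by simp
  neg_mem' {a} ha := by simpa using ha
  mem_or_inv_mem' a := by
    simp only [Set.mem_ofPred_eq]
    rcases eq_or_ne a 0 with rfl | h
    · simp
    rw [HahnSeries.zero_le_orderTop_iff, HahnSeries.zero_le_orderTop_iff]
    have := HahnSeries.order_mul ((map_ne_zero φ).2 h) ((map_ne_zero φ).2 (inv_ne_zero h))
    rw [← map_mul, mul_inv_cancel₀ h, map_one, HahnSeries.order_one] at this
    omega

/-- Along an embedding into `k((π))`, a regular differential `ω` becomes `g dπ` with
`g ∈ k[[π]]`; in terms of the Euler derivation, `π g` has order at least one. -/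
theorem one_le_orderTop_of_mem_regularDifferentials (φ : K →+* k⸨X⸩)
    (hφ : ∀ c : k, φ (algebraMap k K c) = HahnSeries.C c) {T : Ω[K⁄k] →+ k⸨X⸩}
    (hT : ∀ a ω, T (a • ω) = φ a * T ω)
    (hD : ∀ a, T (KaehlerDifferential.D k K a) = eulerDeriv k (φ a)) {ω : Ω[K⁄k]}
    (hω : ω ∈ regularDifferentials k K) : 1 ≤ (T ω).orderTop := by
  have h := hω (placeOfEmbedding φ) fun c => by
    change 0 ≤ (φ (algebraMap k K c)).orderTop
    rw [hφ, HahnSeries.zero_le_orderTop_iff, HahnSeries.order_C]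
  clear hω
  induction h using Submodule.span_induction with
  | mem ω hω =>
    obtain ⟨a, rfl⟩ := hω
    simp only [hD]
    exact one_le_orderTop_eulerDeriv k a.2
  | zero => simp
  | add ω η _ _ h₁ h₂ =>
    rw [map_add]
    exact (le_min h₁ h₂).trans HahnSeries.min_orderTop_le_orderTop_add
  | smul a ω _ h =>
    have : T (a • ω) = φ a * T ω := hT a ω
    rw [this, HahnSeries.orderTop_mul]
    simpa using add_le_add (show 0 ≤ (φ a).orderTop from a.2) h

end Euler

/-! ### Quadratic extensions and involutions -/

section Quadratic
variable {k K : Type*} [Field k] [Field K] [Algebra k K]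

/-- `K` is the quadratic extension `M ⊕ M w` of `M`, obtained by adjoining a square root `w` of an
element of `M`. -/
structure IsSqrtGenerator (M : IntermediateField k K) (w : K) : Prop where
  not_mem : w ∉ M
  sq_mem : w ^ 2 ∈ M
  exists_eq : ∀ z : K, ∃ a b : M, z = a + b * w

variable {M : IntermediateField k K} {w : K}

theorem two_ne_zero_of_algebra (h2 : (2 : k) ≠ 0) : (2 : K) ≠ 0 := by
  have := (map_ne_zero (algebraMap k K)).2 h2
  rwa [map_ofNat] at this

theorem eq_of_add_mul_eq (hw : w ∉ M) {a b a' b' : M}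
    (h : (a : K) + b * w = a' + b' * w) : a = a' ∧ b = b' := by
  have hb : b = b' := by
    by_contra hb
    have hb' : ((b : K) - b') ≠ 0 := fun h0 => hb (Subtype.ext (sub_eq_zero.1 h0))
    refine hw ?_
    have : w = (((a' - a) / (b - b') : M) : K) := by
      push_cast
      rw [eq_div_iff hb']
      linear_combination h
    rw [this]
    exact Subtype.property _
  subst hb
  exact ⟨Subtype.ext (add_right_cancel h), rfl⟩

/-- The sums `a + b w` form a field as soon as `w² ∈ M` and `w ∉ M`. -/
theorem IsSqrtGenerator.of_adjoin (hw : w ∉ M) (hw2 : w ^ 2 ∈ M) {S : Set K}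
    (hS : IntermediateField.adjoin k S = ⊤) (hSM : ∀ s ∈ S, s ∈ M ∨ s = w) :
    IsSqrtGenerator M w := by
  refine ⟨hw, hw2, ?_⟩
  have hmul : ∀ a b c d : M, ((a : K) + b * w) * (c + d * w) =
      ((a * c + b * d * ⟨w ^ 2, hw2⟩ : M) : K) + ((a * d + b * c : M) : K) * w := by
    intro a b c d
    push_cast
    ring
  let N : IntermediateField k K :=
    { carrier := {z | ∃ a b : M, z = a + b * w}
      mul_mem' := by
        rintro _ _ ⟨a, b, rfl⟩ ⟨c, d, rfl⟩
        exact ⟨_, _, hmul a b c d⟩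
      add_mem' := by
        rintro _ _ ⟨a, b, rfl⟩ ⟨c, d, rfl⟩
        exact ⟨a + c, b + d, by push_cast; ring⟩
      algebraMap_mem' := fun c => ⟨algebraMap k M c, 0, by simp⟩
      inv_mem' := by
        rintro _ ⟨a, b, rfl⟩
        -- `(a + b w)⁻¹ = (a - b w) / (a² - b² w²)`
        let n : M := a ^ 2 - b ^ 2 * ⟨w ^ 2, hw2⟩
        have hn : (n : K) = (a + b * w) * (a - b * w) := by
          simp only [n]; push_cast; ring
        by_cases h0 : (n : K) = 0
        · rw [hn] at h0
          have hab : a = 0 ∧ b = 0 := by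
            rcases mul_eq_zero.1 h0 with h | h
            · exact eq_of_add_mul_eq hw (by simpa using h)
            · have := eq_of_add_mul_eq hw (a := a) (b := -b) (a' := 0) (b' := 0)
                (by push_cast; linear_combination h)
              exact ⟨this.1, neg_eq_zero.1 this.2⟩
          exact ⟨0, 0, by simp [hab.1, hab.2]⟩
        · refine ⟨a / n, -b / n, ?_⟩
          have h1 : (a : K) + b * w ≠ 0 := fun h => h0 (by rw [hn, h, zero_mul])
          push_cast
          field_simp
          rw [hn]
          ring }
  have hN : N = ⊤ := by
    rw [eq_top_iff, ← hS, IntermediateField.adjoin_le_iff]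
    intro s hs
    rcases hSM s hs with h | rfl
    · exact ⟨⟨s, h⟩, 0, by simp⟩
    · exact ⟨0, 1, by simp⟩
  intro z
  have : z ∈ N := hN ▸ IntermediateField.mem_top
  exact this

namespace IsSqrtGenerator

theorem ne_zero (h : IsSqrtGenerator M w) : w ≠ 0 := by
  rintro rfl
  exact h.not_mem M.zero_mem

theorem finrank_eq_two (h : IsSqrtGenerator M w) : Module.finrank M K = 2 := by
  have hli : LinearIndependent M ![(1 : K), w] := by
    rw [LinearIndependent.pair_iff]
    intro a b hab
    refine eq_of_add_mul_eq h.not_mem (a' := 0) (b' := 0) ?_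
    simpa [Algebra.smul_def] using hab
  have hsp : ⊤ ≤ Submodule.span M (Set.range ![(1 : K), w]) := by
    intro z _
    obtain ⟨a, b, rfl⟩ := h.exists_eq z
    rw [Matrix.range_cons_cons_empty, Submodule.mem_span_pair]
    exact ⟨a, b, by simp [Algebra.smul_def]⟩
  rw [Module.finrank_eq_card_basis (Module.Basis.mk hli hsp), Fintype.card_fin]

/-- A ring homomorphism `M → L` extends to `M ⊕ M w` by sending `w` to any square root of the
image of `w ^ 2`. -/
theorem exists_ringHom (h : IsSqrtGenerator M w) {L : Type*} [Field L] (i : M →+* L) (v : L)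
    (hv : v ^ 2 = i ⟨w ^ 2, h.sq_mem⟩) :
    ∃ φ : K →+* L, (∀ m : M, φ m = i m) ∧ φ w = v := by
  choose a b hab using h.exists_eq
  have huniq : ∀ z (c d : M), z = c + d * w → a z = c ∧ b z = d := fun z c d hz =>
    eq_of_add_mul_eq h.not_mem (by rw [← hab, hz])
  let φ : K →+* L :=
    { toFun := fun z => i (a z) + i (b z) * v
      map_one' := by
        obtain ⟨h1, h2⟩ := huniq 1 1 0 (by simp)
        simp [h1, h2]
      map_zero' := by
        obtain ⟨h1, h2⟩ := huniq 0 0 0 (by simp)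
        simp [h1, h2]
      map_add' := fun z z' => by
        obtain ⟨h1, h2⟩ := huniq (z + z') (a z + a z') (b z + b z') (by
          push_cast
          linear_combination hab z + hab z')
        rw [h1, h2, map_add, map_add]
        ring
      map_mul' := fun z z' => by
        obtain ⟨h1, h2⟩ := huniq (z * z') (a z * a z' + b z * b z' * ⟨w ^ 2, h.sq_mem⟩)
          (a z * b z' + b z * a z') (by
          conv_lhs => rw [hab z, hab z']
          push_cast
          ring)
        rw [h1, h2]
        simp only [map_add, map_mul, ← hv]
        ring }
  refine ⟨φ, fun m => ?_, ?_⟩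
  · obtain ⟨h1, h2⟩ := huniq m m 0 (by simp)
    change i (a m) + i (b m) * v = _
    simp [h1, h2]
  · obtain ⟨h1, h2⟩ := huniq w 0 1 (by simp)
    change i (a w) + i (b w) * v = _
    simp [h1, h2]

/-- An automorphism fixing `M` and negating `w` is an involution with field of invariants `M`. -/
theorem isInvolutionFixing (h2 : (2 : k) ≠ 0) (h : IsSqrtGenerator M w) (ζ : K ≃ₐ[k] K)
    (hM : ∀ m ∈ M, ζ m = m) (hw : ζ w = -w) : IsInvolutionFixing ζ M := by
  have h2' : (2 : K) ≠ 0 := two_ne_zero_of_algebra h2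
  have key : ∀ a b : M, ζ (a + b * w) = a - b * w := fun a b => by
    rw [map_add, map_mul, hM _ a.2, hM _ b.2, hw]
    ring
  refine ⟨orderOf_eq_prime ?_ ?_, fun z => ⟨hM z, fun hz => ?_⟩⟩
  · ext z
    obtain ⟨a, b, rfl⟩ := h.exists_eq z
    have : ζ (a - b * w) = a + b * w := by
      have := key a (-b)
      push_cast at this
      rw [← sub_neg_eq_add, ← neg_mul, ← this]
      ring_nf
    rw [pow_two, AlgEquiv.mul_apply, key, this, AlgEquiv.one_apply]
  · intro h1
    rw [h1, AlgEquiv.one_apply] at hw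
    exact h.ne_zero ((mul_eq_zero.1 (by linear_combination hw : 2 * w = 0)).resolve_left h2')
  · obtain ⟨a, b, rfl⟩ := h.exists_eq z
    rw [key] at hz
    have hb : (b : K) = 0 := by
      have : 2 * ((b : K) * w) = 0 := by linear_combination -hz
      exact (mul_eq_zero.1 ((mul_eq_zero.1 this).resolve_left h2')).resolve_right h.ne_zero
    rw [hb]
    simp

theorem exists_involution (h2 : (2 : k) ≠ 0) (h : IsSqrtGenerator M w) :
    ∃ ζ : K ≃ₐ[k] K, (∀ m ∈ M, ζ m = m) ∧ ζ w = -w ∧ IsInvolutionFixing ζ M := by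
  obtain ⟨φ, hφ, hφw⟩ := h.exists_ringHom (algebraMap M K) (-w) (by rw [neg_sq]; rfl)
  have hφM : ∀ m ∈ M, φ m = m := fun m hm => hφ ⟨m, hm⟩
  have hinv : ∀ z, φ (φ z) = z := fun z => by
    obtain ⟨a, b, rfl⟩ := h.exists_eq z
    simp [hφM _ a.2, hφM _ b.2, hφw]
  let ζ : K ≃ₐ[k] K := AlgEquiv.ofRingEquiv
    (f := RingEquiv.ofRingHom φ φ (RingHom.ext hinv) (RingHom.ext hinv))
    fun c => hφM _ (M.algebraMap_mem c)
  exact ⟨ζ, hφM, hφw, h.isInvolutionFixing h2 ζ hφM hφw⟩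

end IsSqrtGenerator

/-- Completing the square in a quadratic extension of characteristic different from two. -/
theorem exists_isSqrtGenerator (h2 : (2 : k) ≠ 0) (hM : Module.finrank M K = 2) :
    ∃ w, IsSqrtGenerator M w := by
  have h2' : (2 : K) ≠ 0 := two_ne_zero_of_algebra h2
  have : FiniteDimensional M K := Module.finite_of_finrank_eq_succ hM
  obtain ⟨z, hz⟩ : ∃ z : K, z ∉ M := by
    by_contra! hall
    have hsurj : Function.Surjective (algebraMap M K) := fun z => ⟨⟨z, hall z⟩, rfl⟩
    have h1 : Module.finrank M K = 1 := by
      refine finrank_eq_one (1 : K) one_ne_zero fun z => ?_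
      exact ⟨⟨z, hall z⟩, by simp [Algebra.smul_def]⟩
    omega
  have hzi : IsIntegral M z := IsIntegral.of_finite M z
  have hdeg : (minpoly M z).natDegree = 2 := by
    refine le_antisymm (hM ▸ minpoly.natDegree_le z) ?_
    rw [minpoly.two_le_natDegree_iff hzi]
    rintro ⟨m, rfl⟩
    exact hz m.2
  have hmon := minpoly.monic hzi
  have hroot := minpoly.aeval M z
  rw [aeval_eq_sum_range, hdeg] at hroot
  simp only [Finset.sum_range_succ, Finset.sum_range_zero, Algebra.smul_def] at hroot
  have hlead : (minpoly M z).coeff 2 = 1 := by rw [← hdeg]; exact hmon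
  rw [hlead] at hroot
  set p := (minpoly M z).coeff 1
  set q := (minpoly M z).coeff 0
  have hroot' : (q : K) + p * z + z ^ 2 = 0 := by
    have : ∀ m : M, algebraMap M K m = m := fun _ => rfl
    simpa [this] using hroot
  have hwM : z + p / 2 ∉ M := fun hmem => hz (by
    have hp : ((p / 2 : M) : K) = p / 2 := rfl
    have := M.sub_mem hmem (p / 2 : M).2
    rwa [hp, add_sub_cancel_right] at this)
  refine ⟨z + p / 2, hwM, ?_, fun u => ?_⟩
  · have : (z + p / 2 : K) ^ 2 = ((p ^ 2 / 4 - q : M) : K) := by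
      change _ = (p : K) ^ 2 / 4 - q
      have h4 : (4 : K) ≠ 0 := by
        have : (4 : K) = 2 * 2 := by norm_num
        rw [this]; exact mul_ne_zero h2' h2'
      field_simp
      linear_combination 16 * hroot'
    rw [this]
    exact Subtype.property _
  · have hli : LinearIndependent M ![(1 : K), z + p / 2] := by
      rw [LinearIndependent.pair_iff]
      intro a b hab
      refine eq_of_add_mul_eq hwM (a' := 0) (b' := 0) ?_
      simpa [Algebra.smul_def] using hab
    have hsp := hli.span_eq_top_of_card_eq_finrank (by rw [hM, Fintype.card_fin])
    have hu : u ∈ Submodule.span M (Set.range ![(1 : K), z + p / 2]) := hsp ▸ Submodule.mem_top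
    rw [Matrix.range_cons_cons_empty, Submodule.mem_span_pair] at hu
    obtain ⟨a, b, rfl⟩ := hu
    exact ⟨a, b, by simp [Algebra.smul_def]⟩

end Quadratic

/-! ### Quadratic models of function fields -/

section Model
variable {k K : Type*} [Field k] [Field K] [Algebra k K]

/-- `K = k(x, y)` with `x` transcendental and `y² = f(x)`, where `f` is squarefree and
`y ∉ k(x)`. -/
structure IsSqrtModel (x y : K) (f : k[X]) : Prop where
  transcendental : Transcendental k x
  adjoin_eq_top : IntermediateField.adjoin k {x, y} = ⊤
  sq_eq : y ^ 2 = aeval x f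
  squarefree : Squarefree f
  not_mem : y ∉ k⟮x⟯

theorem aeval_mem_adjoin_simple (x : K) (p : k[X]) : aeval x p ∈ k⟮x⟯ := by
  have := (aeval (IntermediateField.AdjoinSimple.gen k x) p).2
  rwa [← IntermediateField.coe_val, ← aeval_algHom_apply] at this

theorem aeval_ne_zero_of_transcendental {x : K} (hx : Transcendental k x) {p : k[X]} (hp : p ≠ 0) :
    aeval x p ≠ 0 := fun h => hp (transcendental_iff.1 hx p h)

theorem aeval_injective_of_transcendental {x : K} (hx : Transcendental k x) {p q : k[X]}
    (h : aeval x p = aeval x q) : p = q :=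
  (transcendental_iff_injective.1 hx) h

/-- Elements of `k(x)` as fractions in lowest terms. -/
theorem exists_isCoprime_of_mem_adjoin_simple {x A : K} (hA : A ∈ k⟮x⟯) :
    ∃ p q : k[X], q ≠ 0 ∧ IsCoprime p q ∧ A = aeval x p / aeval x q := by
  obtain ⟨r, s, rfl⟩ := (IntermediateField.mem_adjoin_simple_iff k A).1 hA
  by_cases hs : s = 0
  · exact ⟨0, 1, one_ne_zero, isCoprime_one_right, by simp [hs]⟩
  classical
  obtain ⟨g, hg⟩ : ∃ g, g = gcd r s := ⟨_, rfl⟩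
  have hg0 : g ≠ 0 := fun h => hs ((gcd_eq_zero_iff r s).1 (hg ▸ h)).2
  obtain ⟨p, rfl⟩ : g ∣ r := hg ▸ gcd_dvd_left r s
  obtain ⟨q, rfl⟩ : g ∣ s := hg ▸ gcd_dvd_right _ s
  by_cases hgx : aeval x g = 0
  · exact ⟨0, 1, one_ne_zero, isCoprime_one_right, by simp [hgx]⟩
  refine ⟨p, q, right_ne_zero_of_mul hs, ?_, ?_⟩
  · obtain ⟨u, v, huv⟩ := exists_gcd_eq_mul_add_mul (g * p) (g * q)
    refine ⟨u, v, mul_left_cancel₀ hg0 ?_⟩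
    linear_combination -huv - hg
  · rw [map_mul, map_mul, mul_div_mul_left _ _ hgx]

namespace IsSqrtModel

variable {x y : K} {f : k[X]}

theorem isSqrtGenerator (h : IsSqrtModel x y f) : IsSqrtGenerator k⟮x⟯ y :=
  .of_adjoin h.not_mem (h.sq_eq ▸ aeval_mem_adjoin_simple x f) h.adjoin_eq_top (by
    rintro s (rfl | rfl)
    · exact Or.inl (IntermediateField.mem_adjoin_simple_self k _)
    · exact Or.inr rfl)

theorem ne_zero (h : IsSqrtModel x y f) : y ≠ 0 := h.isSqrtGenerator.ne_zero

/-- If `f` is squarefree and not constant, it is not a square in `k(x)`. -/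
theorem of_natDegree_pos (hx : Transcendental k x)
    (hxy : IntermediateField.adjoin k {x, y} = ⊤) (hy : y ^ 2 = aeval x f) (hf : Squarefree f)
    (hd : 0 < f.natDegree) : IsSqrtModel x y f := by
  refine ⟨hx, hxy, hy, hf, fun hmem => ?_⟩
  obtain ⟨p, q, hq, -, rfl⟩ := exists_isCoprime_of_mem_adjoin_simple hmem
  have hqx := aeval_ne_zero_of_transcendental hx hq
  have hpq : p ^ 2 = q ^ 2 * f := by
    apply aeval_injective_of_transcendental hx
    rw [div_pow, div_eq_iff (pow_ne_zero 2 hqx)] at hy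
    rw [map_pow, hy, map_mul, map_pow, mul_comm]
  obtain ⟨c, rfl⟩ := (IsIntegrallyClosed.pow_dvd_pow_iff two_ne_zero).1 (Dvd.intro f hpq.symm)
  have hfc : f = c * c := mul_left_cancel₀ (pow_ne_zero 2 hq) (by rw [← hpq]; ring)
  have hc : IsUnit c := hf c (Dvd.intro_left 1 (by rw [one_mul, hfc]))
  rw [hfc, natDegree_mul' (by simpa using hc.ne_zero), natDegree_eq_zero_of_isUnit hc] at hd
  simp at hd

end IsSqrtModel
end Model

/-! ### Places over zero and poles of regular differentials -/

section Embedding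
variable (k : Type*) [Field k]

/-- The substitution `X ↦ π²`, from polynomials to Laurent series in `π`. -/
noncomputable def substSq : k[X] →+* k⸨X⸩ :=
  (HahnSeries.ofPowerSeries ℤ k).comp
    ((coeToPowerSeries.ringHom (R := k)).comp (expand k 2).toRingHom)

variable {k}

theorem substSq_apply (p : k[X]) :
    substSq k p = HahnSeries.ofPowerSeries ℤ k (expand k 2 p : k[X]) := rfl

theorem substSq_injective : Function.Injective (substSq k) :=
  HahnSeries.ofPowerSeries_injective.comp
    ((Polynomial.coe_injective k).comp (expand_injective two_pos))

theorem substSq_C (c : k) : substSq k (C c) = HahnSeries.C c := by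
  rw [substSq_apply, expand_C, Polynomial.coe_C, HahnSeries.ofPowerSeries_C]

theorem substSq_X : substSq k X = HahnSeries.single 2 1 := by
  rw [substSq_apply, expand_X, Polynomial.coe_pow, Polynomial.coe_X,
    HahnSeries.ofPowerSeries_X_pow]
  rfl

theorem zero_le_order_ofPowerSeries (p : PowerSeries k) :
    0 ≤ (HahnSeries.ofPowerSeries ℤ k p).orderTop := by
  refine HahnSeries.le_orderTop_iff_forall.2 fun n hn => ?_
  have hn' : n < 0 := by exact_mod_cast hn
  rw [PowerSeries.coeff_coe, if_pos hn']

theorem order_substSq_of_eval_ne_zero {p : k[X]} (hp : p.eval 0 ≠ 0) :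
    (substSq k p).order = 0 := by
  refine le_antisymm (HahnSeries.order_le_of_coeff_ne_zero ?_)
    (HahnSeries.zero_le_orderTop_iff.1 (zero_le_order_ofPowerSeries _))
  rw [substSq_apply, PowerSeries.coeff_coe, if_neg (lt_irrefl 0)]
  simpa [coeff_zero_eq_eval_zero] using hp

theorem single_two_ne_zero : (HahnSeries.single 2 1 : k⸨X⸩) ≠ 0 :=
  HahnSeries.single_ne_zero one_ne_zero

theorem two_le_order_substSq {p : k[X]} (hp0 : p ≠ 0) (hp : p.eval 0 = 0) :
    2 ≤ (substSq k p).order := by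
  obtain ⟨q, rfl⟩ := (X_dvd_iff.2 (coeff_zero_eq_eval_zero p ▸ hp) : X ∣ p)
  have hq : q ≠ 0 := right_ne_zero_of_mul hp0
  rw [map_mul, substSq_X, HahnSeries.order_mul single_two_ne_zero
    ((map_ne_zero_iff _ substSq_injective).2 hq), HahnSeries.order_single one_ne_zero]
  have := HahnSeries.zero_le_orderTop_iff.1
    (zero_le_order_ofPowerSeries ((expand k 2 q : k[X]) : PowerSeries k))
  rw [← substSq_apply] at this
  omega

theorem exists_sq_eq_substSq [IsAlgClosed k] (h2 : (2 : k) ≠ 0) {f : k[X]} (hf : f ≠ 0) :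
    ∃ v : k⸨X⸩, v ^ 2 = substSq k f := by
  obtain ⟨g, hg, hndvd⟩ := f.exists_eq_pow_rootMultiplicity_mul_and_not_dvd hf 0
  rw [map_zero, sub_zero] at hg hndvd
  obtain ⟨s, hs⟩ := exists_powerSeries_sq_eq h2 ((expand k 2 g : k[X]) : PowerSeries k) (by
    rw [X_dvd_iff, coeff_zero_eq_eval_zero] at hndvd
    simpa [coeff_zero_eq_eval_zero] using hndvd)
  -- for `f = Xᵐ g` with `g(0) ≠ 0`, take `πᵐ` times a square root of the unit `g(π²)`
  refine ⟨(HahnSeries.single 1 1 : k⸨X⸩) ^ rootMultiplicity 0 f *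
    HahnSeries.ofPowerSeries ℤ k s, ?_⟩
  conv_rhs => rw [hg]
  rw [map_mul, map_pow, substSq_X, mul_pow, ← map_pow (HahnSeries.ofPowerSeries ℤ k), hs,
    ← substSq_apply, ← pow_mul, mul_comm _ 2, pow_mul]
  simp

variable {K : Type*} [Field K] [Algebra k K] {x y : K} {f : k[X]}

/-- The embedding of `k(x)` into `k((π))` with `x ↦ π²`. -/
theorem exists_embedding_adjoin_simple (hx : Transcendental k x) :
    ∃ i : k⟮x⟯ →+* k⸨X⸩, ∀ (p : k[X]) (h : aeval x p ∈ k⟮x⟯), i ⟨aeval x p, h⟩ = substSq k p := by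
  let e := RatFunc.algEquivOfTranscendental x hx
  let j : RatFunc k →+* k⸨X⸩ := RatFunc.liftRingHom (substSq k)
    (nonZeroDivisors_le_comap_nonZeroDivisors_of_injective _ substSq_injective)
  refine ⟨j.comp (e.symm : k⟮x⟯ →+* RatFunc k), fun p h => ?_⟩
  have : (⟨aeval x p, h⟩ : k⟮x⟯) = aeval (IntermediateField.AdjoinSimple.gen k x) p := by
    apply Subtype.ext
    rw [← IntermediateField.coe_val, ← aeval_algHom_apply]
    rfl
  rw [this]
  change j (e.symm _) = _
  rw [RatFunc.algEquivOfTranscendental_symm_aeval, RatFunc.liftRingHom_algebraMap]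

/-- The completions of `K = k(x, y)` at the places over `x = 0`, uniformly in whether `x = 0` is a
branch point: a pair of conjugate embeddings into `k((π))` with `x ↦ π²`. -/
theorem IsSqrtModel.exists_embeddings [IsAlgClosed k] (h2 : (2 : k) ≠ 0)
    (h : IsSqrtModel x y f) :
    ∃ φ φ' : K →+* k⸨X⸩, (∀ p, φ (aeval x p) = substSq k p) ∧
      (∀ p, φ' (aeval x p) = substSq k p) ∧ φ' y = -φ y := by
  obtain ⟨i, hi⟩ := exists_embedding_adjoin_simple h.transcendental
  obtain ⟨v, hv⟩ := exists_sq_eq_substSq h2 h.squarefree.ne_zero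
  have hv' : v ^ 2 = i ⟨y ^ 2, h.isSqrtGenerator.sq_mem⟩ := by
    rw [hv, ← hi f (aeval_mem_adjoin_simple x f)]
    simp only [h.sq_eq]
  obtain ⟨φ, hφ, hφy⟩ := h.isSqrtGenerator.exists_ringHom i v hv'
  obtain ⟨φ', hφ', hφy'⟩ := h.isSqrtGenerator.exists_ringHom i (-v) (by rw [neg_sq, hv'])
  exact ⟨φ, φ', fun p => (hφ ⟨_, aeval_mem_adjoin_simple x p⟩).trans (hi p _),
    fun p => (hφ' ⟨_, aeval_mem_adjoin_simple x p⟩).trans (hi p _), by rw [hφy, hφy']⟩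

/-- The element `A` of `k(x)` has no pole at `x = 0`. -/
def RegularAtZero (k : Type*) [Field k] {K : Type*} [Field K] [Algebra k K] (x A : K) : Prop :=
  ∃ p q : k[X], q.eval 0 ≠ 0 ∧ A = aeval x p / aeval x q

/-- Orders of elements of `k(x)` in `k((π))` are even, so a pole of order at most one is no pole. -/
theorem regularAtZero_of_orderTop (hx : Transcendental k x) {φ : K →+* k⸨X⸩}
    (hφ : ∀ p, φ (aeval x p) = substSq k p) {A : K} (hA : A ∈ k⟮x⟯)
    (h : 1 ≤ (φ A * HahnSeries.single 2 1).orderTop) : RegularAtZero k x A := by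
  obtain ⟨p, q, hq, ⟨u, v, huv⟩, rfl⟩ := exists_isCoprime_of_mem_adjoin_simple hA
  refine ⟨p, q, fun hq0 => ?_, rfl⟩
  have hp0 : p.eval 0 ≠ 0 := fun hp0 => by
    have := congrArg (eval 0) huv
    simp [hp0, hq0] at this
  have hp : p ≠ 0 := fun h => hp0 (by simp [h])
  have hqx := aeval_ne_zero_of_transcendental hx hq
  have hA0 : φ (aeval x p / aeval x q) ≠ 0 :=
    (map_ne_zero φ).2 (div_ne_zero (aeval_ne_zero_of_transcendental hx hp) hqx)
  have hmul : φ (aeval x p / aeval x q) * substSq k q = substSq k p := by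
    rw [← hφ, ← hφ, ← map_mul, div_mul_cancel₀ _ hqx]
  have h1 := congrArg HahnSeries.order hmul
  rw [HahnSeries.order_mul hA0 ((map_ne_zero_iff _ substSq_injective).2 hq),
    order_substSq_of_eval_ne_zero hp0] at h1
  have h2 := two_le_order_substSq hq hq0
  rw [← HahnSeries.order_eq_orderTop_of_ne_zero (mul_ne_zero hA0 single_two_ne_zero),
    HahnSeries.order_mul hA0 single_two_ne_zero, HahnSeries.order_single one_ne_zero] at h
  have h' : (1 : ℤ) ≤ (φ (aeval x p / aeval x q)).order + 2 := by exact_mod_cast h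
  omega

/-- If `(A / y + B) dx` with `A, B ∈ k(x)` is regular, then `A` and `B` have no pole at `x = 0`: the
sum and the difference of its images under the two conjugate embeddings separate `B` from `A`. -/
theorem IsSqrtModel.regularAtZero_of_mem_regularDifferentials [IsAlgClosed k] (h2 : (2 : k) ≠ 0)
    (h : IsSqrtModel x y f) {A B : K} (hA : A ∈ k⟮x⟯) (hB : B ∈ k⟮x⟯)
    (hω : (A / y + B) • KaehlerDifferential.D k K x ∈ regularDifferentials k K) :
    RegularAtZero k x A ∧ RegularAtZero k x B := by
  obtain ⟨φ, φ', hφ, hφ', hφy⟩ := h.exists_embeddings h2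
  have hc : ∀ c, φ (algebraMap k K c) = HahnSeries.C c := fun c => by
    rw [← substSq_C, ← hφ, aeval_C]
  have hc' : ∀ c, φ' (algebraMap k K c) = HahnSeries.C c := fun c => by
    rw [← substSq_C, ← hφ', aeval_C]
  have heq : ∀ {z}, z ∈ k⟮x⟯ → φ' z = φ z := fun {z} hz => by
    obtain ⟨p, q, -, -, rfl⟩ := exists_isCoprime_of_mem_adjoin_simple hz
    rw [map_div₀, map_div₀, hφ, hφ, hφ', hφ']
  have hπ : eulerDeriv k (HahnSeries.single 2 1) = HahnSeries.C 2 * HahnSeries.single 2 1 := by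
    ext n
    rcases eq_or_ne n 2 with rfl | hn
    · simp [HahnSeries.C]
    · simp [HahnSeries.C, HahnSeries.coeff_single_of_ne hn]
  have hx : φ x = HahnSeries.single 2 1 := by rw [← substSq_X, ← hφ, aeval_X]
  have hx' : φ' x = HahnSeries.single 2 1 := by rw [← substSq_X, ← hφ', aeval_X]
  obtain ⟨T, hT, hD⟩ := exists_semilinear_of_embedding φ hc
  obtain ⟨T', hT', hD'⟩ := exists_semilinear_of_embedding φ' hc'
  have h1 := one_le_orderTop_of_mem_regularDifferentials φ hc hT hD hω
  have h1' := one_le_orderTop_of_mem_regularDifferentials φ' hc' hT' hD' hω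
  rw [hT, hD, hx, hπ, map_add, map_div₀] at h1
  rw [hT', hD', hx', hπ, map_add, map_div₀, heq hA, heq hB, hφy] at h1'
  have h4 : (4 : k) ≠ 0 := by
    have : (4 : k) = 2 * 2 := by norm_num
    rw [this]; exact mul_ne_zero h2 h2
  have hC : HahnSeries.C (4 : k)⁻¹ * HahnSeries.C 2 * 2 = (1 : k⸨X⸩) := by
    have : (2 : k⸨X⸩) = HahnSeries.C 2 := (map_ofNat HahnSeries.C 2).symm
    rw [this, ← map_mul, ← map_mul, ← map_one HahnSeries.C]
    congr 1
    field_simp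
    norm_num
  have hmul : ∀ {z w : k⸨X⸩}, 0 ≤ z.orderTop → 1 ≤ w.orderTop → 1 ≤ (z * w).orderTop :=
    fun {z w} hz hw => by
      rw [HahnSeries.orderTop_mul]
      simpa using add_le_add hz hw
  have hCo : ∀ c : k, 0 ≤ (HahnSeries.C c : k⸨X⸩).orderTop := fun c => by
    rw [HahnSeries.zero_le_orderTop_iff, HahnSeries.order_C]
  have hy0 : φ y ≠ 0 := (map_ne_zero φ).2 h.ne_zero
  have hyo : 0 ≤ (φ y).orderTop := by
    have hsq : φ y ^ 2 = substSq k f := by rw [← map_pow, h.sq_eq, hφ]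
    have := HahnSeries.zero_le_orderTop_iff.1
      (zero_le_order_ofPowerSeries ((expand k 2 f : k[X]) : PowerSeries k))
    rw [← substSq_apply, ← hsq, pow_two, HahnSeries.order_mul hy0 hy0] at this
    rw [HahnSeries.zero_le_orderTop_iff]
    omega
  constructor
  · refine regularAtZero_of_orderTop h.transcendental hφ hA ?_
    have h3 := hmul (hCo 4⁻¹) (hmul hyo ((le_min h1 h1').trans
      HahnSeries.min_orderTop_le_orderTop_sub))
    convert h3 using 2
    have hA' : φ A = φ y * (φ A / φ y) := (mul_div_cancel₀ _ hy0).symm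
    rw [div_neg]
    linear_combination HahnSeries.single 2 1 * hA' -
      (φ y * (φ A / φ y) * HahnSeries.single 2 1) * hC
  · refine regularAtZero_of_orderTop h.transcendental hφ hB ?_
    have h3 := hmul (hCo 4⁻¹) ((le_min h1 h1').trans
      HahnSeries.min_orderTop_le_orderTop_add)
    convert h3 using 2
    rw [div_neg]
    linear_combination (-φ B * HahnSeries.single 2 1) * hC

end Embedding

/-! ### Squarefree polynomials under linear substitutions -/

section Squarefree
variable {k : Type*} [Field k]

theorem squarefree_of_forall_sq_not_dvd [IsAlgClosed k] {f : k[X]} (hf : f ≠ 0)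
    (h : ∀ a, ¬ (X - C a) ^ 2 ∣ f) : Squarefree f := by
  rw [squarefree_iff_irreducible_sq_not_dvd_of_ne_zero hf]
  intro q hq hqf
  obtain ⟨a, ha⟩ := IsAlgClosed.exists_root q (by
    rw [IsAlgClosed.degree_eq_one_of_irreducible k hq]; exact one_ne_zero)
  have := dvd_iff_isRoot.2 ha
  exact h a (((pow_dvd_pow_of_dvd this 2).trans (pow_two q).dvd).trans hqf)

theorem not_sq_dvd_of_squarefree {f : k[X]} (hf : Squarefree f) (a : k) :
    ¬ (X - C a) ^ 2 ∣ f := fun h => not_isUnit_X_sub_C a (hf _ (by rwa [pow_two] at h))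

theorem squarefree_comp_linear [IsAlgClosed k] {f : k[X]} (hf : Squarefree f) {b : k} (hb : b ≠ 0)
    (α : k) : Squarefree (f.comp (C b * X + C α)) := by
  have hinv : (C b * X + C α : k[X]).comp (C b⁻¹ * (X - C α)) = X := by
    simp only [add_comp, mul_comp, C_comp, X_comp, ← mul_assoc, ← C_mul, mul_inv_cancel₀ hb]
    simp
  have hcomp : (f.comp (C b * X + C α)).comp (C b⁻¹ * (X - C α)) = f := by
    rw [comp_assoc, hinv, comp_X]
  refine squarefree_of_forall_sq_not_dvd (fun h => hf.ne_zero ?_) fun a ⟨g, hg⟩ => ?_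
  · rw [← hcomp, h, zero_comp]
  · rw [hg, mul_comp, pow_comp, pow_two] at hcomp
    have hu := hf _ (Dvd.intro _ hcomp)
    have hd := natDegree_eq_zero_of_isUnit hu
    rw [natDegree_comp, natDegree_X_sub_C, natDegree_C_mul (inv_ne_zero hb),
      natDegree_X_sub_C] at hd
    omega

/-- The polynomial `X ^ (2 n) f(1 / X)` is squarefree if `f` is, even when it vanishes at zero:
this happens only for `f` of degree `2 n - 1`, and then to first order. -/
theorem squarefree_reflect [IsAlgClosed k] {f : k[X]} (hf : Squarefree f) {n : ℕ} (hn : 1 ≤ n)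
    (hd : f.natDegree ≤ 2 * n) (hd' : 2 * n ≤ f.natDegree + 1) :
    Squarefree (reflect (2 * n) f) := by
  have hinv : reflect (2 * n) (reflect (2 * n) f) = f := by
    ext i
    rw [coeff_reflect, coeff_reflect, revAt_invol]
  refine squarefree_of_forall_sq_not_dvd (fun h => hf.ne_zero ?_) fun a hdvd => ?_
  · rw [← hinv, h, reflect_zero]
  rcases eq_or_ne a 0 with rfl | ha
  · rw [map_zero, sub_zero, X_pow_dvd_iff] at hdvd
    have h0 := hdvd 0 two_pos
    have h1 := hdvd 1 one_lt_two
    rw [coeff_reflect, revAt_le (by omega)] at h0 h1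
    refine hf.ne_zero (leadingCoeff_eq_zero.1 ?_)
    rcases (by omega : f.natDegree = 2 * n - 0 ∨ f.natDegree = 2 * n - 1) with h | h
    · rw [leadingCoeff, h, h0]
    · rw [leadingCoeff, h, h1]
  · obtain ⟨r, hr⟩ := hdvd
    have hr0 : r ≠ 0 := by
      rintro rfl
      rw [mul_zero] at hr
      exact hf.ne_zero (by rw [← hinv, hr, reflect_zero])
    have hrd : r.natDegree ≤ 2 * n - 2 := by
      have h1 : (reflect (2 * n) f).natDegree ≤ 2 * n :=
        natDegree_reflect_le.trans (max_le le_rfl hd)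
      rw [hr, natDegree_mul (pow_ne_zero 2 (X_sub_C_ne_zero a)) hr0, natDegree_pow,
        natDegree_X_sub_C] at h1
      omega
    have h1 : (X - C a).natDegree ≤ 1 := natDegree_X_sub_C_le a
    have hfac : f = (reflect 1 (X - C a) * reflect 1 (X - C a)) * reflect (2 * n - 2) r := by
      rw [← reflect_mul _ _ h1 h1, ← reflect_mul _ _ (by rw [← pow_two, natDegree_pow]; omega) hrd,
        ← pow_two, ← hr, show 1 + 1 + (2 * n - 2) = 2 * n by omega, hinv]
    have hu := hf _ (Dvd.intro _ hfac.symm)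
    have hd := natDegree_eq_zero_of_isUnit hu
    rw [reflect_sub, reflect_one_X, reflect_C, pow_one, natDegree_sub_C_aux ha] at hd
    omega
where
  natDegree_sub_C_aux {a : k} (ha : a ≠ 0) : (1 - C a * X : k[X]).natDegree = 1 := by
    rw [natDegree_sub_eq_right_of_natDegree_lt] <;> simp [natDegree_C_mul_X a ha]

end Squarefree

/-! ### Changes of model -/

section Transform
variable {k K : Type*} [Field k] [Field K] [Algebra k K]

theorem transcendental_of_mem_adjoin_simple {x x' : K} (hx : Transcendental k x)
    (h : x ∈ k⟮x'⟯) : Transcendental k x' := by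
  intro hx'
  have := IntermediateField.isAlgebraic_adjoin_simple (isAlgebraic_iff_isIntegral.1 hx')
  exact hx ((IntermediateField.isAlgebraic_iff (x := (⟨x, h⟩ : k⟮x'⟯))).1
    (Algebra.IsAlgebraic.isAlgebraic _))

namespace IsSqrtModel
variable {x y : K} {f : k[X]}

/-- Replacing `x` by another generator `x'` of `k(x)` and `y` by a multiple `y' = y u` with
`u ∈ k(x)`. -/
theorem change (h : IsSqrtModel x y f) {x' y' u : K} {f' : k[X]} (hx : k⟮x'⟯ = k⟮x⟯)
    (hu : u ∈ k⟮x⟯) (hu0 : u ≠ 0) (hy : y' = y * u) (hsq : y' ^ 2 = aeval x' f')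
    (hf : Squarefree f') : IsSqrtModel x' y' f' := by
  have hle : k⟮x⟯ ≤ IntermediateField.adjoin k {x', y'} := by
    rw [← hx]
    exact IntermediateField.adjoin.mono k _ _ (by simp)
  refine ⟨transcendental_of_mem_adjoin_simple h.transcendental
    (hx ▸ IntermediateField.mem_adjoin_simple_self k x), ?_, hsq, hf, fun hmem => h.not_mem ?_⟩
  · rw [eq_top_iff, ← h.adjoin_eq_top, IntermediateField.adjoin_le_iff]
    rintro s (rfl | rfl)
    · exact hle (IntermediateField.mem_adjoin_simple_self k _)
    · have : s = y' / u := by rw [hy, mul_div_cancel_right₀ _ hu0]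
      rw [this]
      exact div_mem (IntermediateField.subset_adjoin k _ (by simp)) (hle hu)
  · have : y = y' / u := by rw [hy, mul_div_cancel_right₀ _ hu0]
    rw [this]
    exact div_mem (hx ▸ hmem) hu

theorem translate [IsAlgClosed k] (h : IsSqrtModel x y f) (α : k) :
    k⟮x - algebraMap k K α⟯ = k⟮x⟯ ∧
      IsSqrtModel (x - algebraMap k K α) y (f.comp (X + C α)) := by
  have hx : k⟮x - algebraMap k K α⟯ = k⟮x⟯ := by
    apply le_antisymm <;> rw [IntermediateField.adjoin_simple_le_iff]
    · exact sub_mem (IntermediateField.mem_adjoin_simple_self k x)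
        (IntermediateField.algebraMap_mem _ α)
    · have := add_mem (IntermediateField.mem_adjoin_simple_self k (x - algebraMap k K α))
        (IntermediateField.algebraMap_mem _ α)
      rwa [sub_add_cancel] at this
  refine ⟨hx, h.change hx (one_mem _) one_ne_zero (mul_one y).symm ?_ ?_⟩
  · rw [h.sq_eq, aeval_comp]
    simp
  · have := squarefree_comp_linear h.squarefree one_ne_zero α
    rwa [C_1, one_mul] at this

theorem x_ne_zero (h : IsSqrtModel x y f) : x ≠ 0 := by
  rintro rfl
  exact h.transcendental isAlgebraic_zero

end IsSqrtModel

theorem aeval_reflect_inv {x : K} (hx : x ≠ 0) {N : ℕ} {f : k[X]} (hf : f.natDegree ≤ N) :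
    aeval x⁻¹ (reflect N f) * x ^ N = aeval x f := by
  let := invertibleOfNonzero hx
  have := eval₂_reflect_mul_pow (algebraMap k K) x N f hf
  rwa [invOf_eq_inv] at this

namespace IsSqrtModel
variable {x y : K} {f : k[X]}

theorem invert [IsAlgClosed k] (h : IsSqrtModel x y f) {n : ℕ} (hn : 1 ≤ n)
    (hd : f.natDegree ≤ 2 * n) (hd' : 2 * n ≤ f.natDegree + 1) :
    k⟮x⁻¹⟯ = k⟮x⟯ ∧ IsSqrtModel x⁻¹ (y * x⁻¹ ^ n) (reflect (2 * n) f) := by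
  have hx0 := h.x_ne_zero
  have hx : k⟮x⁻¹⟯ = k⟮x⟯ := by
    apply le_antisymm <;> rw [IntermediateField.adjoin_simple_le_iff]
    · exact inv_mem (IntermediateField.mem_adjoin_simple_self k x)
    · have := inv_mem (IntermediateField.mem_adjoin_simple_self k x⁻¹)
      rwa [inv_inv] at this
  refine ⟨hx, h.change hx (pow_mem (inv_mem (IntermediateField.mem_adjoin_simple_self k x)) n)
    (pow_ne_zero n (inv_ne_zero hx0)) rfl ?_ (squarefree_reflect h.squarefree hn hd hd')⟩
  rw [mul_pow, h.sq_eq, ← aeval_reflect_inv hx0 hd, ← pow_mul, mul_comm n 2, mul_assoc, ← mul_pow,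
    mul_inv_cancel₀ hx0, one_pow, mul_one]

/-- Every differential is a multiple of `dx`. -/
theorem exists_smul_D_eq (h2 : (2 : k) ≠ 0) (h : IsSqrtModel x y f) (ω : Ω[K⁄k]) :
    ∃ g : K, g • KaehlerDifferential.D k K x = ω := by
  rw [← Submodule.mem_span_singleton]
  set S := Submodule.span K {KaehlerDifferential.D k K x}
  have hx : KaehlerDifferential.D k K x ∈ S := Submodule.mem_span_singleton_self _
  have hy : KaehlerDifferential.D k K y ∈ S := by
    have h1 : (2 * y) • KaehlerDifferential.D k K y =
        aeval x (derivative f) • KaehlerDifferential.D k K x := by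
      rw [← Derivation.map_aeval, ← h.sq_eq, Derivation.leibniz_pow]
      simp [mul_smul, two_smul]
    have h3 : (2 * y) ≠ 0 := mul_ne_zero (two_ne_zero_of_algebra h2) h.ne_zero
    rw [← one_smul K (KaehlerDifferential.D k K y), ← inv_mul_cancel₀ h3, mul_smul, h1]
    exact S.smul_mem _ (S.smul_mem _ hx)
  have hall : ∀ z : K, KaehlerDifferential.D k K z ∈ S := fun z => by
    have hz : z ∈ IntermediateField.adjoin k {x, y} := h.adjoin_eq_top ▸ IntermediateField.mem_top
    induction hz using IntermediateField.adjoin_induction with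
    | mem z hz =>
      rcases hz with rfl | rfl
      · exact hx
      · exact hy
    | algebraMap c => simp
    | add a b _ _ ha hb => rw [map_add]; exact S.add_mem ha hb
    | inv a _ ha => rw [Derivation.leibniz_inv]; exact S.smul_mem _ ha
    | mul a b _ _ ha hb =>
      rw [Derivation.leibniz]
      exact S.add_mem (S.smul_mem _ hb) (S.smul_mem _ ha)
  have hω : ω ∈ Submodule.span K (Set.range (KaehlerDifferential.D k K)) := by
    rw [KaehlerDifferential.span_range_derivation]; trivial
  refine Submodule.span_le.2 ?_ hω
  rintro _ ⟨z, rfl⟩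
  exact hall z

end IsSqrtModel
end Transform

/-! ### Regular differentials of a quadratic model -/

section Regular
variable {k K : Type*} [Field k] [Field K] [Algebra k K]

theorem aeval_mem_valuationSubring {O : ValuationSubring K} (hO : ∀ c : k, algebraMap k K c ∈ O)
    {x : K} (hx : x ∈ O) (p : k[X]) : aeval x p ∈ O := by
  rw [aeval_eq_sum_range]
  refine sum_mem fun i _ => ?_
  rw [Algebra.smul_def]
  exact mul_mem (hO _) (pow_mem hx i)

theorem mem_valuationSubring_of_sq_mem {O : ValuationSubring K} {y : K} (hy : y ^ 2 ∈ O) :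
    y ∈ O := by
  rcases O.mem_or_inv_mem y with h | h
  · exact h
  · rcases eq_or_ne y 0 with rfl | hy0
    · exact zero_mem O
    · have := mul_mem hy h
      rwa [pow_two, mul_assoc, mul_inv_cancel₀ hy0, mul_one] at this

/-- If `y² = f(x)` with `f` separable, say `u f + v f' = 1`, then
`dx / y = u(x) y dx + 2 v(x) dy` is regular wherever `x` is. -/
theorem inv_smul_D_mem_span {x y : K} {f : k[X]} (hy0 : y ≠ 0) (hy : y ^ 2 = aeval x f)
    (hf : f.Separable) {O : ValuationSubring K} (hO : ∀ c : k, algebraMap k K c ∈ O)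
    (hx : x ∈ O) :
    y⁻¹ • KaehlerDifferential.D k K x ∈
      Submodule.span O (Set.range fun a : O => KaehlerDifferential.D k K (a : K)) := by
  have hyO : y ∈ O := mem_valuationSubring_of_sq_mem (hy ▸ aeval_mem_valuationSubring hO hx f)
  obtain ⟨u, v, huv⟩ := hf
  have h1 : (2 * y) • KaehlerDifferential.D k K y =
      aeval x (derivative f) • KaehlerDifferential.D k K x := by
    rw [← Derivation.map_aeval, ← hy, Derivation.leibniz_pow]
    simp [mul_smul, two_smul]
  have h2 : aeval x u * y ^ 2 + aeval x v * aeval x (derivative f) = 1 := by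
    have := congrArg (aeval x) huv
    rwa [map_add, map_mul, map_mul, map_one, ← hy] at this
  have h3 : y⁻¹ • KaehlerDifferential.D k K x = (aeval x u * y) • KaehlerDifferential.D k K x
      + (2 * aeval x v) • KaehlerDifferential.D k K y := by
    have h4 : y⁻¹ = aeval x u * y + y⁻¹ * aeval x v * aeval x (derivative f) := by
      rw [inv_eq_iff_eq_inv, eq_comm, inv_eq_iff_eq_inv, ← one_div, eq_div_iff hy0]
      field_simp
      linear_combination h2
    rw [h4, add_smul, mul_smul _ (aeval x (derivative f)), ← h1, smul_smul]
    congr 2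
    field_simp
  rw [h3]
  have hu := mul_mem (aeval_mem_valuationSubring hO hx u) hyO
  have hv := mul_mem (ofNat_mem O 2) (aeval_mem_valuationSubring hO hx v)
  exact add_mem (Submodule.smul_mem _ (⟨_, hu⟩ : O) (Submodule.subset_span ⟨⟨x, hx⟩, rfl⟩))
    (Submodule.smul_mem _ (⟨_, hv⟩ : O) (Submodule.subset_span ⟨⟨y, hyO⟩, rfl⟩))

/-- An element of `k(x)` without poles at finite distance is a polynomial in `x`. -/
theorem exists_aeval_eq_of_regular [IsAlgClosed k] {x A : K} (hx : Transcendental k x)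
    (hA : A ∈ k⟮x⟯) (h : ∀ α : k, RegularAtZero k (x - algebraMap k K α) A) :
    ∃ p : k[X], A = aeval x p := by
  obtain ⟨p, q, hq, ⟨u, v, huv⟩, rfl⟩ := exists_isCoprime_of_mem_adjoin_simple hA
  by_cases hd : q.degree = 0
  · rw [eq_C_of_degree_eq_zero hd]
    refine ⟨C (q.coeff 0)⁻¹ * p, ?_⟩
    simp [div_eq_inv_mul]
  exfalso
  obtain ⟨α, hα⟩ := IsAlgClosed.exists_root q hd
  obtain ⟨r, s, hs, hrs⟩ := h α
  have hcomp : ∀ p : k[X], aeval (x - algebraMap k K α) p = aeval x (p.comp (X - C α)) :=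
    fun p => by simp [aeval_comp]
  have hs' : (s.comp (X - C α)).eval α ≠ 0 := by simpa [eval_comp] using hs
  have hs0 : s.comp (X - C α) ≠ 0 := fun h => hs' (by simp [h])
  rw [hcomp, hcomp, div_eq_div_iff (aeval_ne_zero_of_transcendental hx hq)
    (aeval_ne_zero_of_transcendental hx hs0), ← map_mul, ← map_mul] at hrs
  have h1 := congrArg (eval α) (aeval_injective_of_transcendental hx hrs)
  rw [eval_mul, eval_mul, hα.eq_zero, mul_zero] at h1
  have hp := (mul_eq_zero.1 h1).resolve_right hs'
  have h2 := congrArg (eval α) huv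
  simp [hp, hα.eq_zero] at h2

/-- If `p(x) x² x⁻ᵐ` has no pole at infinity, then `deg p + 2 ≤ m`. -/
theorem natDegree_add_two_le_of_regular {x : K} (hx0 : x ≠ 0)
    {p : k[X]} (hp : p ≠ 0) {m : ℕ} (h : RegularAtZero k x⁻¹ (aeval x p * x ^ 2 * x⁻¹ ^ m))
    (ht : Transcendental k x⁻¹) : p.natDegree + 2 ≤ m := by
  obtain ⟨r, s, hs, hrs⟩ := h
  have hs0 : s ≠ 0 := fun h => hs (by simp [h])
  by_contra! hm
  rw [← aeval_reflect_inv hx0 le_rfl, eq_div_iff (aeval_ne_zero_of_transcendental ht hs0)] at hrs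
  obtain ⟨e, he⟩ := Nat.exists_eq_add_of_lt hm
  have hpoly : reflect p.natDegree p * s = r * X ^ (e + 1) := by
    apply aeval_injective_of_transcendental ht
    rw [map_mul, map_mul, ← hrs, map_pow, aeval_X]
    have h1 : x ^ p.natDegree * x ^ 2 * (x⁻¹ ^ m * x⁻¹ ^ (e + 1)) = 1 := by
      rw [← pow_add, ← pow_add, he, add_assoc m, ← mul_pow, mul_inv_cancel₀ hx0, one_pow]
    linear_combination (-(aeval x⁻¹ (reflect p.natDegree p)) * aeval x⁻¹ s) * h1
  have h0 := congrArg (eval 0) hpoly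
  rw [eval_mul, eval_mul, eval_pow, eval_X, zero_pow (by omega), mul_zero,
    ← coeff_zero_eq_eval_zero, coeff_reflect, revAt_zero] at h0
  exact (mul_ne_zero (leadingCoeff_ne_zero.2 hp) hs) h0

namespace IsSqrtModel
variable [IsAlgClosed k] {x y : K} {f : k[X]} {n : ℕ}

/-- The embedding `x ↦ π²` carries `dx` to `2 π dπ`, which is not zero. -/
theorem D_x_ne_zero (h2 : (2 : k) ≠ 0) (h : IsSqrtModel x y f) :
    KaehlerDifferential.D k K x ≠ 0 := by
  obtain ⟨φ, -, hφ, -, -⟩ := h.exists_embeddings h2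
  have hc : ∀ c, φ (algebraMap k K c) = HahnSeries.C c := fun c => by
    rw [← substSq_C, ← hφ, aeval_C]
  obtain ⟨T, -, hD⟩ := exists_semilinear_of_embedding φ hc
  intro h0
  have h1 := hD x
  have hx : φ x = HahnSeries.single 2 1 := by rw [← substSq_X, ← hφ, aeval_X]
  rw [h0, map_zero, hx] at h1
  have h3 := congrArg (fun z : k⸨X⸩ => z.coeff 2) h1
  simp only [coeff_eulerDeriv, HahnSeries.coeff_zero, HahnSeries.coeff_single_same] at h3
  exact h2 (by push_cast at h3; linear_combination -h3)

/-- The differentials `p(x) dx / y` with `deg p < n - 1` are regular. -/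
theorem aeval_div_smul_D_mem (h : IsSqrtModel x y f) (hn : 1 ≤ n)
    (hd : f.natDegree ≤ 2 * n) (hd' : 2 * n ≤ f.natDegree + 1) {p : k[X]}
    (hp : p ∈ degreeLT k (n - 1)) :
    (aeval x p / y) • KaehlerDifferential.D k K x ∈ regularDifferentials k K := by
  intro O hO
  by_cases hx : x ∈ O
  · rw [div_eq_mul_inv, mul_smul]
    exact Submodule.smul_mem _ (⟨_, aeval_mem_valuationSubring hO hx p⟩ : O)
      (inv_smul_D_mem_span h.ne_zero h.sq_eq (PerfectField.separable_iff_squarefree.2 h.squarefree)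
        hO hx)
  · have ht := (O.mem_or_inv_mem x).resolve_left hx
    rcases eq_or_ne p 0 with rfl | hp0
    · simp
    have hpd : p.natDegree + 2 ≤ n := by
      have := (natDegree_lt_iff_degree_lt hp0).2 (mem_degreeLT.1 hp)
      omega
    obtain ⟨-, hw⟩ := h.invert hn hd hd'
    have hx0 := h.x_ne_zero
    -- with `t = 1 / x` and `w = y tⁿ`, the differential is `-q(t) dt / w` for a polynomial `q`
    have key : (aeval x p / y) • KaehlerDifferential.D k K x =
        (-aeval x⁻¹ (reflect (n - 2) p)) • (y * x⁻¹ ^ n)⁻¹ • KaehlerDifferential.D k K x⁻¹ := by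
      rw [Derivation.leibniz_inv, smul_smul, smul_smul,
        ← aeval_reflect_inv (N := n - 2) hx0 (by omega)]
      congr 1
      obtain ⟨m, rfl⟩ := Nat.exists_eq_add_of_le' (show 2 ≤ n by omega)
      have hy0 := h.ne_zero
      rw [Nat.add_sub_cancel]
      generalize aeval x⁻¹ (reflect m p) = r
      simp only [inv_pow]
      field_simp
      ring
    rw [key]
    exact Submodule.smul_mem _
      (⟨_, neg_mem (aeval_mem_valuationSubring hO ht (reflect (n - 2) p))⟩ : O)
      (inv_smul_D_mem_span hw.ne_zero hw.sq_eq
        (PerfectField.separable_iff_squarefree.2 hw.squarefree) hO ht)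

/-- The regular differentials of `y² = f(x)`, with `f` squarefree of degree `2 n - 1` or `2 n`,
are the `p(x) dx / y` with `deg p < n - 1`. -/
theorem mem_regularDifferentials_iff (h2 : (2 : k) ≠ 0) (h : IsSqrtModel x y f) (hn : 1 ≤ n)
    (hd : f.natDegree ≤ 2 * n) (hd' : 2 * n ≤ f.natDegree + 1) {ω : Ω[K⁄k]} :
    ω ∈ regularDifferentials k K ↔
      ∃ p ∈ degreeLT k (n - 1), (aeval x p / y) • KaehlerDifferential.D k K x = ω := by
  refine ⟨fun hω => ?_, fun ⟨p, hp, hpω⟩ => hpω ▸ h.aeval_div_smul_D_mem hn hd hd' hp⟩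
  obtain ⟨g, rfl⟩ := h.exists_smul_D_eq h2 ω
  obtain ⟨A, B, hAB⟩ : ∃ A B : k⟮x⟯, g = A / y + B := by
    obtain ⟨A, B, hAB⟩ := h.isSqrtGenerator.exists_eq (g * y)
    refine ⟨A, B, ?_⟩
    have hy0 := h.ne_zero
    field_simp
    linear_combination hAB
  rw [hAB] at hω ⊢
  have hx0 := h.x_ne_zero
  have hfin : ∀ α : k, RegularAtZero k (x - algebraMap k K α) (A : K) ∧
      RegularAtZero k (x - algebraMap k K α) (B : K) := fun α => by
    obtain ⟨hk, hm⟩ := h.translate α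
    refine hm.regularAtZero_of_mem_regularDifferentials h2 (by rw [hk]; exact A.2)
      (by rw [hk]; exact B.2) ?_
    simpa using hω
  obtain ⟨P, hP⟩ := exists_aeval_eq_of_regular h.transcendental A.2 fun α => (hfin α).1
  obtain ⟨Q, hQ⟩ := exists_aeval_eq_of_regular h.transcendental B.2 fun α => (hfin α).2
  obtain ⟨hk, hm⟩ := h.invert hn hd hd'
  -- with `t = 1 / x` and `w = y tⁿ`, one has `(P / y + Q) dx = (-P x² tⁿ / w - Q x²) dt`
  have hinf : RegularAtZero k x⁻¹ (aeval x (-P) * x ^ 2 * x⁻¹ ^ n) ∧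
      RegularAtZero k x⁻¹ (aeval x (-Q) * x ^ 2 * x⁻¹ ^ 0) := by
    have hx : x ∈ k⟮x⁻¹⟯ := hk ▸ IntermediateField.mem_adjoin_simple_self k x
    have hpol : ∀ p : k[X], aeval x p ∈ k⟮x⁻¹⟯ := fun p => hk ▸ aeval_mem_adjoin_simple x p
    refine hm.regularAtZero_of_mem_regularDifferentials h2
      (mul_mem (mul_mem (hpol _) (pow_mem hx 2)) (pow_mem (inv_mem hx) n))
      (mul_mem (mul_mem (hpol _) (pow_mem hx 2)) (pow_mem (inv_mem hx) 0)) ?_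
    convert hω using 1
    rw [Derivation.leibniz_inv, smul_smul, hP, hQ]
    congr 1
    have hy0 := h.ne_zero
    rw [map_neg, map_neg]
    field_simp
    ring
  have hQ0 : Q = 0 := by
    by_contra hQ0
    have := natDegree_add_two_le_of_regular hx0 (neg_ne_zero.2 hQ0) hinf.2
      hm.transcendental
    omega
  refine ⟨P, ?_, ?_⟩
  · rcases eq_or_ne P 0 with rfl | hP0
    · exact zero_mem _
    have := natDegree_add_two_le_of_regular hx0 (neg_ne_zero.2 hP0) hinf.1
      hm.transcendental
    rw [natDegree_neg] at this
    rw [mem_degreeLT, ← natDegree_lt_iff_degree_lt hP0]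
    omega
  · rw [hP, hQ, hQ0, map_zero, add_zero]

theorem genus_eq (h2 : (2 : k) ≠ 0) (h : IsSqrtModel x y f) (hn : 1 ≤ n)
    (hd : f.natDegree ≤ 2 * n) (hd' : 2 * n ≤ f.natDegree + 1) : genus k K = n - 1 := by
  let Λ : k[X] →ₗ[k] Ω[K⁄k] :=
    { toFun := fun p => (aeval x p / y) • KaehlerDifferential.D k K x
      map_add' := fun p q => by rw [map_add, add_div, add_smul]
      map_smul' := fun c p => by
        rw [map_smul, RingHom.id_apply, smul_div_assoc, smul_assoc] }
  have hΛ : Function.Injective Λ := by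
    rw [injective_iff_map_eq_zero]
    intro p hp
    by_contra hp0
    exact (smul_ne_zero (div_ne_zero (aeval_ne_zero_of_transcendental h.transcendental hp0)
      h.ne_zero) (h.D_x_ne_zero h2)) hp
  have hmap : regularDifferentials k K = (degreeLT k (n - 1)).map Λ := by
    ext ω
    rw [h.mem_regularDifferentials_iff h2 hn hd hd', Submodule.mem_map]
    rfl
  rw [genus, hmap, ← (Submodule.equivMapOfInjective Λ hΛ _).finrank_eq,
    (degreeLTEquiv k (n - 1)).finrank_eq, Module.finrank_fin_fun]

end IsSqrtModel
end Regular

/-! ### Existence of models -/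

section Existence
variable {k K : Type*} [Field k] [Field K] [Algebra k K]

theorem exists_sq_mul_squarefree {r : k[X]} (hr : r ≠ 0) :
    ∃ g f : k[X], g ≠ 0 ∧ Squarefree f ∧ r = g ^ 2 * f := by
  induction hd : r.natDegree using Nat.strong_induction_on generalizing r with
  | _ d ih =>
    by_cases hs : Squarefree r
    · exact ⟨1, r, one_ne_zero, hs, by ring⟩
    · rw [Squarefree] at hs
      push Not at hs
      obtain ⟨q, ⟨r', rfl⟩, hu⟩ := hs
      have hq : q ≠ 0 := by
        rintro rfl
        simp at hr
      have hr' : r' ≠ 0 := right_ne_zero_of_mul hr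
      have hqd : 0 < q.natDegree := by
        by_contra! h0
        rw [eq_C_of_natDegree_le_zero h0] at hu hq
        exact hu (isUnit_C.2 (isUnit_iff_ne_zero.2 fun h => hq (by rw [h, map_zero])))
      rw [natDegree_mul (mul_ne_zero hq hq) hr', natDegree_mul hq hq] at hd
      obtain ⟨g, f, hg, hf, rfl⟩ := ih r'.natDegree (by omega) hr' rfl
      exact ⟨q * g, f, mul_ne_zero hq hg, hf, by ring⟩

/-- A quadratic extension of `k(x)` is obtained by adjoining the square root of a squarefree
polynomial in `x`. -/
theorem exists_isSqrtModel (h2 : (2 : k) ≠ 0) {x : K} (hx : Transcendental k x)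
    (hd : Module.finrank k⟮x⟯ K = 2) : ∃ (y : K) (f : k[X]), IsSqrtModel x y f := by
  obtain ⟨w, hw⟩ := exists_isSqrtGenerator h2 hd
  obtain ⟨p, q, hq, -, hpq⟩ := exists_isCoprime_of_mem_adjoin_simple hw.sq_mem
  have hqx := aeval_ne_zero_of_transcendental hx hq
  have hp : p ≠ 0 := by
    rintro rfl
    rw [map_zero, zero_div] at hpq
    exact hw.ne_zero (pow_eq_zero_iff two_ne_zero |>.1 hpq)
  obtain ⟨g, f, hg, hf, hr⟩ := exists_sq_mul_squarefree (mul_ne_zero hp hq)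
  have hgx := aeval_ne_zero_of_transcendental hx hg
  have hu : aeval x q / aeval x g ∈ k⟮x⟯ :=
    div_mem (aeval_mem_adjoin_simple x q) (aeval_mem_adjoin_simple x g)
  have hu0 := div_ne_zero hqx hgx
  set y := w * (aeval x q / aeval x g) with hy
  have hwy : w = y / (aeval x q / aeval x g) := by rw [hy, mul_div_cancel_right₀ _ hu0]
  refine ⟨y, f, hx, ?_, ?_, hf, fun hmem => hw.not_mem (by rw [hwy]; exact div_mem hmem hu)⟩
  · rw [eq_top_iff]
    intro z _
    have hle : k⟮x⟯ ≤ IntermediateField.adjoin k {x, y} :=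
      IntermediateField.adjoin.mono k _ _ (by simp)
    obtain ⟨a, b, rfl⟩ := hw.exists_eq z
    refine add_mem (hle a.2) (mul_mem (hle b.2) ?_)
    rw [hwy]
    exact div_mem (IntermediateField.subset_adjoin k _ (by simp)) (hle hu)
  · have hr' := congrArg (aeval x) hr
    rw [map_mul, map_mul, map_pow] at hr'
    rw [hy, mul_pow, hpq, div_pow]
    field_simp
    linear_combination hr'

/-- Over an algebraically closed field a constant `f` would make `y` a constant. -/
theorem IsSqrtModel.natDegree_pos [IsAlgClosed k] {x y : K} {f : k[X]} (h : IsSqrtModel x y f) :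
    0 < f.natDegree := by
  by_contra! h0
  have hsq := h.sq_eq
  rw [eq_C_of_natDegree_le_zero h0, aeval_C] at hsq
  obtain ⟨s, hs⟩ := IsAlgClosed.exists_pow_nat_eq (f.coeff 0) two_pos
  rw [← hs, map_pow] at hsq
  rcases sq_eq_sq_iff_eq_or_eq_neg.1 hsq with h1 | h1 <;> refine h.not_mem ?_ <;> rw [h1]
  · exact IntermediateField.algebraMap_mem _ s
  · exact neg_mem (IntermediateField.algebraMap_mem _ s)

/-- The degree of `f` is `2 g + 1` or `2 g + 2`. -/
theorem IsSqrtModel.natDegree_of_genus [IsAlgClosed k] (h2 : (2 : k) ≠ 0) {x y : K} {f : k[X]}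
    (h : IsSqrtModel x y f) {g : ℕ} (hg : genus k K = g) :
    f.natDegree ≤ 2 * (g + 1) ∧ 2 * (g + 1) ≤ f.natDegree + 1 := by
  have h0 := h.natDegree_pos
  have h1 := h.genus_eq h2 (n := (f.natDegree + 1) / 2) (by omega) (by omega) (by omega)
  omega

theorem IsSqrtModel.map_algEquiv {x y : K} {f : k[X]} (h : IsSqrtModel x y f) (ζ : K ≃ₐ[k] K) :
    IsSqrtModel (ζ x) (ζ y) f := by
  have hmap : ∀ S : Set K, IntermediateField.adjoin k (ζ '' S) =
      (IntermediateField.adjoin k S).map (ζ : K →ₐ[k] K) := fun S => by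
    rw [IntermediateField.adjoin_map]; rfl
  refine ⟨fun hx => h.transcendental ((isAlgebraic_algHom_iff (ζ : K →ₐ[k] K) ζ.injective).1 hx),
    ?_, ?_, h.squarefree, fun hmem => h.not_mem ?_⟩
  · rw [← Set.image_pair, hmap, h.adjoin_eq_top, eq_top_iff]
    intro z _
    exact ⟨ζ.symm z, trivial, ζ.apply_symm_apply z⟩
  · rw [← map_pow, h.sq_eq, aeval_algHom_apply]
  · rw [← Set.image_singleton, hmap] at hmem
    obtain ⟨z, hz, hzy⟩ := hmem
    rwa [← ζ.injective hzy]

theorem adjoin_eq_top_of_coe_image {F : IntermediateField k K} {S : Set F}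
    (h : F = IntermediateField.adjoin k (Subtype.val '' S)) :
    IntermediateField.adjoin k S = ⊤ := by
  apply IntermediateField.lift_injective F
  rw [IntermediateField.lift_adjoin, IntermediateField.lift_top, ← h]

/-- A rational function field has genus zero: it is the function field of `y² = x`. -/
theorem genus_adjoin_simple [IsAlgClosed k] (h2 : (2 : k) ≠ 0) {x : K} (hx : Transcendental k x) :
    genus k k⟮x⟯ = 0 := by
  set t := IntermediateField.AdjoinSimple.gen k x
  have ht : Transcendental k t := fun h => hx (IntermediateField.isAlgebraic_iff.1 h)
  have hm : IsSqrtModel (t ^ 2) t (X : k[X]) := by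
    refine .of_natDegree_pos (ht.pow two_pos) ?_ (aeval_X _).symm irreducible_X.squarefree
      (by rw [natDegree_X]; exact one_pos)
    rw [eq_top_iff, ← adjoin_eq_top_of_coe_image (F := k⟮x⟯) (S := {t})
      (by rw [Set.image_singleton]; rfl)]
    exact IntermediateField.adjoin.mono k _ _ (by simp)
  exact hm.genus_eq h2 (n := 1) le_rfl (by simp) (by simp)

end Existence

/-! ### Involutions act on the line by fractional linear maps -/

section Moebius
variable {k K : Type*} [Field k] [IsAlgClosed k] [Field K] [Algebra k K]

/-- Two quadratic models of a function field of genus three have `x`-coordinates which differ by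
a fractional linear transformation. The regular differentials `xⁱ dx / y`, `i = 0, 1, 2`, of the
second model are `pᵢ dx / y` in the first, with `deg pᵢ ≤ 2` and `p₁² = p₀ p₂`. -/
theorem IsSqrtModel.exists_moebius (h2 : (2 : k) ≠ 0) (hg : genus k K = 3) {x y x' y' : K}
    {f f' : k[X]} (h : IsSqrtModel x y f) (h' : IsSqrtModel x' y' f') :
    ∃ a b : k[X], a ≠ 0 ∧ a.natDegree ≤ 1 ∧ b.natDegree ≤ 1 ∧ x' * aeval x a = aeval x b := by
  obtain ⟨hd, hd'⟩ := h.natDegree_of_genus h2 hg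
  obtain ⟨he, he'⟩ := h'.natDegree_of_genus h2 hg
  have key : ∀ i < 3, ∃ p : k[X], p ∈ degreeLT k 3 ∧
      (aeval x p / y) • KaehlerDifferential.D k K x =
        (x' ^ i / y') • KaehlerDifferential.D k K x' := fun i hi => by
    refine (h.mem_regularDifferentials_iff h2 (n := 4) (by omega) hd hd').1 ?_
    refine (h'.mem_regularDifferentials_iff h2 (n := 4) (by omega) he he').2 ⟨X ^ i, ?_, by simp⟩
    rw [mem_degreeLT, degree_X_pow]
    exact_mod_cast hi
  obtain ⟨p₀, hp₀, h₀⟩ := key 0 (by omega)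
  obtain ⟨p₁, hp₁, h₁⟩ := key 1 (by omega)
  obtain ⟨p₂, hp₂, h₂⟩ := key 2 (by omega)
  have hD := h.D_x_ne_zero h2
  have hy := h.ne_zero
  have e₁ : x' * aeval x p₀ = aeval x p₁ := by
    have : (x' * (aeval x p₀ / y)) • KaehlerDifferential.D k K x =
        (aeval x p₁ / y) • KaehlerDifferential.D k K x := by
      rw [mul_smul, h₀, h₁, smul_smul]
      congr 1
      ring
    have := smul_left_injective K hD this
    field_simp at this
    exact this
  have e₂ : x' * aeval x p₁ = aeval x p₂ := by
    have : (x' * (aeval x p₁ / y)) • KaehlerDifferential.D k K x =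
        (aeval x p₂ / y) • KaehlerDifferential.D k K x := by
      rw [mul_smul, h₁, h₂, smul_smul]
      congr 1
      ring
    have := smul_left_injective K hD this
    field_simp at this
    exact this
  have hp₀0 : p₀ ≠ 0 := by
    rintro rfl
    rw [map_zero, zero_div, zero_smul] at h₀
    exact smul_ne_zero (div_ne_zero (pow_ne_zero 0 h'.x_ne_zero) h'.ne_zero)
      (h'.D_x_ne_zero h2) h₀.symm
  have hsq : p₁ * p₁ = p₀ * p₂ := by
    apply aeval_injective_of_transcendental h.transcendental
    rw [map_mul, map_mul]
    linear_combination (aeval x p₀) * e₂ - (aeval x p₁) * e₁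
  -- in lowest terms `p₁ / p₀ = b / a`; then `p₁² = p₀ p₂` forces `p₀ = a² e` and `p₂ = b² e`
  classical
  obtain ⟨g, hgdef⟩ : ∃ g, g = gcd p₀ p₁ := ⟨_, rfl⟩
  obtain ⟨a, rfl⟩ : g ∣ p₀ := hgdef ▸ gcd_dvd_left p₀ p₁
  obtain ⟨b, rfl⟩ : g ∣ p₁ := hgdef ▸ gcd_dvd_right _ p₁
  have hg0 : g ≠ 0 := left_ne_zero_of_mul hp₀0
  have ha0 : a ≠ 0 := right_ne_zero_of_mul hp₀0
  have hcop : IsCoprime a b := by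
    obtain ⟨u, v, huv⟩ := exists_gcd_eq_mul_add_mul (g * a) (g * b)
    exact ⟨u, v, mul_left_cancel₀ hg0 (by linear_combination -huv - hgdef)⟩
  have hsq' : g * (b * b) = a * p₂ := mul_left_cancel₀ hg0 (by linear_combination hsq)
  obtain ⟨e, rfl⟩ : a ∣ g := (hcop.mul_right hcop).dvd_of_dvd_mul_right (Dvd.intro _ hsq'.symm)
  have he0 : e ≠ 0 := right_ne_zero_of_mul hg0
  have hp₂' : p₂ = e * (b * b) := (mul_left_cancel₀ ha0 (by linear_combination hsq')).symm
  have hdeg : ∀ {p : k[X]}, p ≠ 0 → p ∈ degreeLT k 3 → p.natDegree ≤ 2 := fun {p} hp0 hp => by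
    have := (natDegree_lt_iff_degree_lt hp0).2 (mem_degreeLT.1 hp)
    omega
  refine ⟨a, b, ha0, ?_, ?_, ?_⟩
  · have := hdeg hp₀0 hp₀
    rw [natDegree_mul hg0 ha0, natDegree_mul ha0 he0] at this
    omega
  · rcases eq_or_ne b 0 with rfl | hb0
    · simp
    have hb := mul_ne_zero hb0 hb0
    have := hdeg (hp₂' ▸ mul_ne_zero he0 hb) hp₂
    rw [hp₂', natDegree_mul he0 hb, natDegree_mul hb0 hb0] at this
    omega
  · have hgx := aeval_ne_zero_of_transcendental h.transcendental hg0
    apply mul_left_cancel₀ hgx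
    rw [map_mul _ (a * e) a, map_mul _ (a * e) b] at e₁
    linear_combination e₁

/-- An involution acting on `k(x)` by a nontrivial fractional linear transformation negates a
suitable generator of `k(x)`. -/
theorem exists_negated_generator (h2 : (2 : k) ≠ 0) {x : K} (hx : Transcendental k x)
    (ζ : K ≃ₐ[k] K) (hζ : ∀ z, ζ (ζ z) = z) {a b : k[X]} (ha : a ≠ 0) (had : a.natDegree ≤ 1)
    (hbd : b.natDegree ≤ 1) (hab : ζ x * aeval x a = aeval x b) (hne : ζ x ≠ x) :
    ∃ X : K, k⟮X⟯ = k⟮x⟯ ∧ ζ X = -X := by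
  have h2' : (2 : K) ≠ 0 := two_ne_zero_of_algebra h2
  have hconst : ∀ c : k, x ≠ algebraMap k K c := fun c h => hx (h ▸ isAlgebraic_algebraMap c)
  have hmem : ∀ c : k, algebraMap k K c ∈ k⟮x⟯ := fun c => IntermediateField.algebraMap_mem _ c
  have hxm : x ∈ k⟮x⟯ := IntermediateField.mem_adjoin_simple_self k x
  rw [eq_X_add_C_of_natDegree_le_one had, eq_X_add_C_of_natDegree_le_one hbd] at hab
  set γ := a.coeff 1
  set δ := a.coeff 0
  set α := b.coeff 1
  set β := b.coeff 0
  simp only [map_add, map_mul, aeval_C, aeval_X] at hab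
  have hab' := congrArg ζ hab
  simp only [map_add, map_mul, AlgEquiv.commutes, hζ] at hab'
  set x' := ζ x
  -- a matrix whose square is scalar, though it is not scalar itself, has trace zero
  have htr : algebraMap k K δ = -algebraMap k K α := by
    have h1 : (algebraMap k K δ + algebraMap k K α) * (x' - x) = 0 := by
      linear_combination hab - hab'
    exact eq_neg_of_add_eq_zero_left ((mul_eq_zero.1 h1).resolve_right (sub_ne_zero.2 hne))
  by_cases hγ : γ = 0
  · have hα : algebraMap k K α ≠ 0 := fun h0 => ha (by
      rw [h0, neg_zero, map_eq_zero] at htr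
      rw [eq_X_add_C_of_natDegree_le_one had]
      change C γ * X + C δ = 0
      rw [hγ, htr]; simp)
    rw [hγ, map_zero, htr] at hab
    let c : k := -β / (2 * α)
    have hc : 2 * algebraMap k K c * algebraMap k K α = -algebraMap k K β := by
      simp only [c, map_div₀, map_mul, map_neg, map_ofNat]
      field_simp
    refine ⟨x - algebraMap k K c, le_antisymm ?_ ?_, ?_⟩
    · rw [IntermediateField.adjoin_simple_le_iff]
      exact sub_mem hxm (hmem c)
    · rw [IntermediateField.adjoin_simple_le_iff]
      have := add_mem (IntermediateField.mem_adjoin_simple_self k (x - algebraMap k K c))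
        (IntermediateField.algebraMap_mem _ c)
      rwa [sub_add_cancel] at this
    · rw [map_sub, AlgEquiv.commutes]
      apply mul_left_cancel₀ hα
      change algebraMap k K α * (x' - algebraMap k K c) = _
      linear_combination -hab - hc
  · have hγ' : algebraMap k K γ ≠ 0 := (_root_.map_ne_zero _).2 hγ
    -- the fixed points of the transformation on `u = x - α / γ` are the square roots `± s` below
    obtain ⟨s, hs⟩ := IsAlgClosed.exists_pow_nat_eq (β / γ + (α / γ) ^ 2) two_pos
    set c := algebraMap k K (α / γ)
    set S := algebraMap k K s
    have hc : c * algebraMap k K γ = algebraMap k K α := by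
      simp only [c, map_div₀]
      field_simp
    have hS : S ^ 2 * algebraMap k K γ = algebraMap k K β + c ^ 2 * algebraMap k K γ := by
      have h1 := congrArg (algebraMap k K) hs
      rw [map_pow, map_add, map_pow, map_div₀ _ β] at h1
      change S ^ 2 = _ + c ^ 2 at h1
      rw [h1, add_mul, div_mul_cancel₀ _ hγ']
    have huu : (x - c) * (x' - c) = S ^ 2 := by
      apply mul_left_cancel₀ hγ'
      rw [htr] at hab
      linear_combination hab - hS - (x + x') * hc
    have hu : x - c ≠ 0 := sub_ne_zero.2 (hconst _)
    have hu' : x' - c ≠ 0 := fun h0 => hu (by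
      have := congrArg ζ h0
      simpa [x', c, hζ] using this)
    have hS0 : S ≠ 0 := fun h0 => mul_ne_zero hu hu' (by rw [huu, h0]; ring)
    have hus : x - c + S ≠ 0 := fun h0 => hconst (α / γ - s) (by
      rw [map_sub]; linear_combination h0)
    have hus' : x' - c + S ≠ 0 := fun h0 => hus (by
      have := congrArg ζ h0
      simpa [x', c, S, hζ] using this)
    refine ⟨(x - c - S) / (x - c + S), le_antisymm ?_ ?_, ?_⟩
    · rw [IntermediateField.adjoin_simple_le_iff]
      exact div_mem (sub_mem (sub_mem hxm (hmem _)) (hmem _))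
        (add_mem (sub_mem hxm (hmem _)) (hmem _))
    · rw [IntermediateField.adjoin_simple_le_iff]
      set X := (x - c - S) / (x - c + S) with hX
      have hX1 : 1 - X ≠ 0 := by
        have : 1 - X = 2 * S / (x - c + S) := by
          rw [hX]; field_simp; ring
        rw [this]
        exact div_ne_zero (mul_ne_zero h2' hS0) hus
      have hxX : x = S * (1 + X) / (1 - X) + c := by
        have : X * (x - c + S) = x - c - S := div_mul_cancel₀ _ hus
        field_simp
        linear_combination -this
      have hXm := IntermediateField.mem_adjoin_simple_self k X
      have hcm : ∀ c : k, algebraMap k K c ∈ k⟮X⟯ := fun c => IntermediateField.algebraMap_mem _ c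
      rw [hxX]
      exact add_mem (div_mem (mul_mem (hcm _) (add_mem (one_mem _) hXm))
        (sub_mem (one_mem _) hXm)) (hcm _)
    · have hζX : ζ ((x - c - S) / (x - c + S)) = (x' - c - S) / (x' - c + S) := by
        simp [x', c, S]
      rw [hζX, eq_neg_iff_add_eq_zero, div_add_div _ _ hus' hus, div_eq_zero_iff]
      left
      linear_combination 2 * huu

end Moebius

/-! ### The quartic and its discriminant -/

section Quartic
variable {k : Type*} [Field k]

/-- The polynomial `T⁴ + a T³ + b T² + c T + 1`. -/
noncomputable def quartic (a b c : k) : k[X] := X ^ 4 + C a * X ^ 3 + C b * X ^ 2 + C c * X + 1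

theorem natDegree_quartic (a b c : k) : (quartic a b c).natDegree = 4 := by
  unfold quartic; compute_degree!

theorem quartic_monic (a b c : k) : (quartic a b c).Monic := by
  unfold quartic; monicity!

theorem squarefree_of_expand [IsAlgClosed k] {g : k[X]} (h : Squarefree (expand k 2 g)) :
    Squarefree g := by
  refine squarefree_of_forall_sq_not_dvd (fun h0 => h.ne_zero (by rw [h0, map_zero]))
    fun a ⟨r, hr⟩ => ?_
  have hu := h (expand k 2 (X - C a)) (by
    rw [hr, map_mul, map_pow, pow_two]
    exact dvd_mul_right _ _)
  have := natDegree_eq_zero_of_isUnit hu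
  rw [natDegree_expand, natDegree_X_sub_C] at this
  omega

theorem squarefree_X_mul_quartic {a b c : k} (h : Squarefree (quartic a b c)) :
    Squarefree (X * quartic a b c) := by
  have hcop : IsCoprime X (quartic a b c) :=
    ⟨-(X ^ 3 + C a * X ^ 2 + C b * X + C c), 1, by rw [quartic]; ring⟩
  exact squarefree_mul_iff.2 ⟨hcop.isRelPrime, irreducible_X.squarefree, h⟩

theorem coeff_eq_of_quartic_eq {a b c d a' b' c' d' : k}
    (h : X ^ 4 + C a * X ^ 3 + C b * X ^ 2 + C c * X + C d =
      X ^ 4 + C a' * X ^ 3 + C b' * X ^ 2 + C c' * X + C d') :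
    a = a' ∧ b = b' ∧ c = c' ∧ d = d' := by
  refine ⟨?_, ?_, ?_, ?_⟩
  · simpa [coeff_X, coeff_C] using congrArg (fun p => coeff p 3) h
  · simpa [coeff_X, coeff_C] using congrArg (fun p => coeff p 2) h
  · simpa [coeff_X, coeff_C] using congrArg (fun p => coeff p 1) h
  · simpa [coeff_X, coeff_C] using congrArg (fun p => coeff p 0) h

/-- In terms of the roots `α, β, γ, δ` of the quartic, whose product is one, `Δ` is `256` times the
fourth power of the product of the differences `α - β`, …, `γ - δ`. -/
theorem Δ_ne_zero_of_squarefree [IsAlgClosed k] (h2 : (2 : k) ≠ 0) {a b c : k}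
    (h : Squarefree (quartic a b c)) : Δ a b c ≠ 0 := by
  have hs := IsAlgClosed.splits (quartic a b c)
  have hcard : Multiset.card (quartic a b c).roots = 4 := by
    rw [← hs.natDegree_eq_card_roots, natDegree_quartic]
  have hprod := hs.eq_prod_roots_of_monic (quartic_monic a b c)
  obtain ⟨α, t, ht, hcard⟩ := Multiset.card_eq_succ_iff.1 hcard
  obtain ⟨β, u, hu, hcard⟩ := Multiset.card_eq_succ_iff.1 hcard
  obtain ⟨γ, v, hv, hcard⟩ := Multiset.card_eq_succ_iff.1 hcard
  obtain ⟨δ, rfl⟩ := Multiset.card_eq_one.1 hcard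
  rw [← ht, ← hu, ← hv] at hprod
  simp only [Multiset.map_cons, Multiset.map_singleton, Multiset.prod_cons,
    Multiset.prod_singleton] at hprod
  have hne : ∀ {p q : k} (r : k[X]), quartic a b c = (X - C p) * (X - C q) * r → p ≠ q := by
    rintro p q r hr rfl
    exact not_sq_dvd_of_squarefree h p ⟨r, by rw [hr, pow_two]⟩
  have hαβ : α ≠ β := hne ((X - C γ) * (X - C δ)) (by rw [hprod]; ring)
  have hαγ : α ≠ γ := hne ((X - C β) * (X - C δ)) (by rw [hprod]; ring)
  have hαδ : α ≠ δ := hne ((X - C β) * (X - C γ)) (by rw [hprod]; ring)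
  have hβγ : β ≠ γ := hne ((X - C α) * (X - C δ)) (by rw [hprod]; ring)
  have hβδ : β ≠ δ := hne ((X - C α) * (X - C γ)) (by rw [hprod]; ring)
  have hγδ : γ ≠ δ := hne ((X - C α) * (X - C β)) (by rw [hprod]; ring)
  have hexp : X ^ 4 + C a * X ^ 3 + C b * X ^ 2 + C c * X + C 1 =
      X ^ 4 + C (-(α + β + γ + δ)) * X ^ 3
        + C (α * β + α * γ + α * δ + β * γ + β * δ + γ * δ) * X ^ 2
        + C (-(α * β * γ + α * β * δ + α * γ * δ + β * γ * δ)) * X + C (α * β * γ * δ) := by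
    rw [C_1]
    change quartic a b c = _
    rw [hprod]
    simp only [map_add, map_mul, map_neg]
    ring
  obtain ⟨ha, hb, hc, he⟩ := coeff_eq_of_quartic_eq hexp
  -- the discriminant of a monic quartic, homogeneous in the roots
  have hdisc : ∀ e : k, e = α * β * γ * δ →
      -256 * e ^ 3 + 80 * b ^ 2 * a * c * e - 18 * b * a ^ 3 * c * e - 18 * a * c ^ 3 * b
        - b ^ 2 * a ^ 2 * c ^ 2 + 6 * a ^ 2 * c ^ 2 * e - 144 * c ^ 2 * b * e + 4 * a ^ 3 * c ^ 3
        + 4 * b ^ 3 * a ^ 2 * e + 4 * b ^ 3 * c ^ 2 + 128 * b ^ 2 * e ^ 2 - 144 * b * a ^ 2 * e ^ 2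
        + 192 * a * c * e ^ 2 - 16 * b ^ 4 * e + 27 * c ^ 4 + 27 * a ^ 4 * e ^ 2 =
      -((α - β) * (α - γ) * (α - δ) * (β - γ) * (β - δ) * (γ - δ)) ^ 2 := by
    rintro e rfl
    rw [ha, hb, hc]
    ring
  have hΔ : Δ a b c =
      2 ^ 8 * (-((α - β) * (α - γ) * (α - δ) * (β - γ) * (β - δ) * (γ - δ)) ^ 2) ^ 2 := by
    rw [← hdisc 1 he, Δ]
    ring
  rw [hΔ]
  refine mul_ne_zero (pow_ne_zero _ h2) (pow_ne_zero _ (neg_ne_zero.2 (pow_ne_zero _ ?_)))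
  simp only [mul_ne_zero_iff, sub_ne_zero]
  exact ⟨⟨⟨⟨⟨hαβ, hαγ⟩, hαδ⟩, hβγ⟩, hβδ⟩, hγδ⟩

end Quartic

/-! ### The even normal form -/

section NormalForm
variable {k K : Type*} [Field k] [IsAlgClosed k] [Field K] [Algebra k K]

/-- If an involution `ζ` negates `x`, then it maps `y` to `± y`, and `f` is even. This follows by
comparing the regular differentials `dx / y` and `ζ(dx / y) = -dx / ζ(y)`. -/
theorem IsSqrtModel.even_of_negated (h2 : (2 : k) ≠ 0) {x y : K} {f : k[X]}
    (h : IsSqrtModel x y f) {g : ℕ} (hg1 : 1 ≤ g) (hg : genus k K = g) (ζ : K ≃ₐ[k] K)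
    (hζ : ∀ z, ζ (ζ z) = z) (hx : ζ x = -x) :
    f.comp (C (-1) * X) = f ∧ (ζ y = y ∨ ζ y = -y) := by
  obtain ⟨hd, hd'⟩ := h.natDegree_of_genus h2 hg
  have h' := h.map_algEquiv ζ
  have hy0 := h.ne_zero
  have hy0' := h'.ne_zero
  obtain ⟨p, -, hp⟩ := (h.mem_regularDifferentials_iff h2 (by omega) hd hd').1
    ((h'.mem_regularDifferentials_iff h2 (by omega) hd hd').2 ⟨1, by
      rw [mem_degreeLT, degree_one]; exact_mod_cast hg1, rfl⟩)
  rw [hx, map_neg, smul_neg, ← neg_smul] at hp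
  have hyy := smul_left_injective K (h.D_x_ne_zero h2) hp
  simp only [map_one] at hyy
  have hyp : y = -(aeval x p * ζ y) := by
    field_simp at hyy
    rw [hyy, neg_neg]
  have hsq' : ζ y ^ 2 = aeval x (f.comp (C (-1) * X)) := by
    rw [h'.sq_eq, hx, aeval_comp]
    simp
  have hff : f = p * p * f.comp (C (-1) * X) := by
    apply aeval_injective_of_transcendental h.transcendental
    rw [map_mul, map_mul, ← hsq', ← h.sq_eq]
    nth_rw 1 [hyp]
    ring
  obtain ⟨c, -, rfl⟩ := isUnit_iff.1 (h.squarefree p (Dvd.intro _ hff.symm))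
  rw [aeval_C] at hyp
  have hyp' := congrArg ζ hyp
  rw [map_neg, map_mul, AlgEquiv.commutes, hζ] at hyp'
  have hc : (algebraMap k K c) ^ 2 = 1 := by
    apply mul_right_cancel₀ hy0
    linear_combination -hyp + algebraMap k K c * hyp'
  refine ⟨?_, ?_⟩
  · rw [← map_pow, ← map_one (algebraMap k K)] at hc
    have hc' : c * c = 1 := by
      rw [← pow_two]; exact (algebraMap k K).injective hc
    rw [← C_mul, hc', C_1, one_mul] at hff
    exact hff.symm
  · rcases sq_eq_one_iff.1 hc with h1 | h1 <;> rw [h1] at hyp'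
    · right; linear_combination hyp'
    · left; linear_combination hyp'

/-- A function field of genus three with an involution negating `x` has the model
`y² = x⁸ + a x⁶ + b x⁴ + c x² + 1`, after rescaling `x` and `y`. -/
theorem IsSqrtModel.exists_normal_form (h2 : (2 : k) ≠ 0) {x y : K} {f : k[X]}
    (h : IsSqrtModel x y f) (hg : genus k K = 3) (ζ : K ≃ₐ[k] K)
    (hζ : ∀ z, ζ (ζ z) = z) (hx : ζ x = -x) :
    ∃ (x' y' : K) (a b c : k), IsSqrtModel x' y' (expand k 2 (quartic a b c)) ∧
      ζ x' = -x' ∧ (ζ y' = y' ∨ ζ y' = -y') := by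
  obtain ⟨hd, hd'⟩ := h.natDegree_of_genus h2 hg
  obtain ⟨heven, hy⟩ := h.even_of_negated h2 (by norm_num) hg ζ hζ hx
  have hodd : ∀ i, Odd i → f.coeff i = 0 := fun i hi => by
    have h1 := congrArg (fun p => coeff p i) heven
    simp only [comp_C_mul_X_coeff, hi.neg_one_pow] at h1
    exact (mul_eq_zero.1 (by linear_combination -h1 : 2 * f.coeff i = 0)).resolve_left h2
  have hd8 : f.natDegree = 8 := by
    rcases (by omega : f.natDegree = 7 ∨ f.natDegree = 8) with h7 | h8
    · have h7' := hodd 7 (by decide)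
      rw [← h7] at h7'
      exact absurd h7' (leadingCoeff_ne_zero.2 h.squarefree.ne_zero)
    · exact h8
  have h8 : f.coeff 8 ≠ 0 := hd8 ▸ leadingCoeff_ne_zero.2 h.squarefree.ne_zero
  -- an even polynomial vanishing at zero is divisible by `X²`
  have h0 : f.coeff 0 ≠ 0 := fun h0 => by
    refine not_sq_dvd_of_squarefree h.squarefree 0 ?_
    rw [map_zero, sub_zero, X_pow_dvd_iff]
    intro i hi
    interval_cases i
    · exact h0
    · exact hodd 1 (by decide)
  have hf : f = C (f.coeff 8) * X ^ 8 + C (f.coeff 6) * X ^ 6 + C (f.coeff 4) * X ^ 4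
      + C (f.coeff 2) * X ^ 2 + C (f.coeff 0) := by
    conv_lhs => rw [f.as_sum_range' 9 (by omega)]
    simp only [Finset.sum_range_succ, Finset.sum_range_zero, ← C_mul_X_pow_eq_monomial,
      hodd 1 (by decide), hodd 3 (by decide), hodd 5 (by decide), hodd 7 (by decide)]
    simp only [map_zero]
    ring
  generalize f.coeff 8 = e₈ at *
  generalize f.coeff 6 = e₆ at *
  generalize f.coeff 4 = e₄ at *
  generalize f.coeff 2 = e₂ at *
  generalize f.coeff 0 = e₀ at *
  -- the scalings `x ↦ s x`, `y ↦ y / m` make the leading and the constant coefficient one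
  obtain ⟨s, hs⟩ := IsAlgClosed.exists_pow_nat_eq (e₈ / e₀) (show 0 < 8 by norm_num)
  obtain ⟨m, hm⟩ := IsAlgClosed.exists_pow_nat_eq e₀ two_pos
  have hs0 : s ≠ 0 := by
    rintro rfl
    exact div_ne_zero h8 h0 (by rw [← hs, zero_pow (by norm_num)])
  have hm0 : m ≠ 0 := by
    rintro rfl
    exact h0 (by rw [← hm, zero_pow two_ne_zero])
  have hpoly : expand k 2 (quartic (e₀⁻¹ * e₆ * s⁻¹ ^ 6) (e₀⁻¹ * e₄ * s⁻¹ ^ 4)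
      (e₀⁻¹ * e₂ * s⁻¹ ^ 2)) = C e₀⁻¹ * f.comp (C s⁻¹ * X + C 0) := by
    have e1 : C e₀⁻¹ * C e₈ * C s⁻¹ ^ 8 = (1 : k[X]) := by
      rw [← C_pow, ← C_mul, ← C_mul, ← C_1]
      congr 1
      rw [inv_pow, hs]
      field_simp
    have e2 : C e₀⁻¹ * C e₀ = (1 : k[X]) := by
      rw [← C_mul, inv_mul_cancel₀ h0, C_1]
    rw [hf]
    simp only [quartic, map_add, map_mul, map_pow, expand_X, expand_C, map_one, add_comp, mul_comp,
      pow_comp, C_comp, X_comp, map_zero, add_zero]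
    linear_combination -X ^ 8 * e1 - e2
  have hsqf : Squarefree (C e₀⁻¹ * f.comp (C s⁻¹ * X + C 0)) := by
    have hu : IsUnit (C e₀⁻¹) := isUnit_C.2 (isUnit_iff_ne_zero.2 (inv_ne_zero h0))
    exact (associated_unit_mul_left _ _ hu).symm.squarefree_iff.1
      (squarefree_comp_linear h.squarefree (inv_ne_zero hs0) 0)
  have hsK : algebraMap k K s ≠ 0 := (_root_.map_ne_zero _).2 hs0
  have hmK : algebraMap k K m ≠ 0 := (_root_.map_ne_zero _).2 hm0
  refine ⟨algebraMap k K s * x, y * algebraMap k K m⁻¹, _, _, _,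
    h.change ?_ (IntermediateField.algebraMap_mem _ m⁻¹) ?_ rfl ?_ (hpoly ▸ hsqf), ?_, ?_⟩
  · apply le_antisymm <;> rw [IntermediateField.adjoin_simple_le_iff]
    · exact mul_mem (IntermediateField.algebraMap_mem _ s)
        (IntermediateField.mem_adjoin_simple_self k x)
    · have := mul_mem (IntermediateField.algebraMap_mem _ s⁻¹)
        (IntermediateField.mem_adjoin_simple_self k (algebraMap k K s * x))
      rwa [map_inv₀, inv_mul_cancel_left₀ hsK] at this
  · exact (_root_.map_ne_zero _).2 (inv_ne_zero hm0)
  · rw [hpoly, mul_pow, h.sq_eq, map_mul, aeval_C, aeval_comp, ← map_pow, inv_pow, hm, mul_comm]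
    congr 2
    simp [hsK]
  · rw [map_mul, AlgEquiv.commutes, hx, mul_neg]
  · rw [map_mul, AlgEquiv.commutes]
    rcases hy with hy | hy <;> rw [hy]
    · exact Or.inl rfl
    · exact Or.inr (neg_mul _ _)

end NormalForm

/-! ### The two quadratic subfields -/

section Subfields
variable {k K : Type*} [Field k] [Field K] [Algebra k K]

theorem IsSqrtModel.isFunctionField {x y : K} {f : k[X]} (h : IsSqrtModel x y f) :
    IsFunctionField k K :=
  ⟨x, h.transcendental, Module.finite_of_finrank_eq_succ h.isSqrtGenerator.finrank_eq_two⟩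

/-- The field `k(x², x y)` has genus two: it is the function field of `Y² = X g(X)`. -/
theorem isFunctionFieldOfGenus_adjoin_sq_mul [IsAlgClosed k] (h2 : (2 : k) ≠ 0) {x y : K}
    {a b c : k} (h : IsSqrtModel x y (expand k 2 (quartic a b c))) :
    IsFunctionFieldOfGenus k (IntermediateField.adjoin k {x ^ 2, y * x}) 2 := by
  set M := IntermediateField.adjoin k {x ^ 2, y * x} with hM
  let X' : M := ⟨x ^ 2, IntermediateField.subset_adjoin k _ (by simp)⟩
  let Y' : M := ⟨y * x, IntermediateField.subset_adjoin k _ (by simp)⟩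
  have hdeg : (X * quartic a b c).natDegree = 5 := by
    rw [natDegree_mul X_ne_zero (quartic_monic a b c).ne_zero, natDegree_X, natDegree_quartic]
  have hm : IsSqrtModel X' Y' (X * quartic a b c) := by
    refine .of_natDegree_pos (fun hX => h.transcendental.pow two_pos
      (IntermediateField.isAlgebraic_iff.1 hX)) ?_ ?_
      (squarefree_X_mul_quartic (squarefree_of_expand h.squarefree)) (by omega)
    · apply adjoin_eq_top_of_coe_image
      rw [Set.image_pair]
    · apply Subtype.ext
      change (y * x) ^ 2 = M.val (aeval X' (X * quartic a b c))
      rw [← aeval_algHom_apply, map_mul, aeval_X, mul_pow, h.sq_eq, expand_aeval, mul_comm]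
      rfl
  exact ⟨hm.isFunctionField, hm.genus_eq h2 (n := 3) (by norm_num) (by omega) (by omega)⟩

theorem eq_of_isInvolutionFixing {ζ : K ≃ₐ[k] K} {M N : IntermediateField k K}
    (hM : IsInvolutionFixing ζ M) (hN : IsInvolutionFixing ζ N) : M = N := by
  ext z
  rw [hM.2, hN.2]

/-- If `K = k(x, y)` and the automorphism `σ` negates `x` and fixes `z`, where `z` is `y` or
`y x`, then `k(x², z)` is the field of invariants of `σ`, and `K` is quadratic over it. -/
theorem isInvolutionFixing_adjoin_sq (h2 : (2 : k) ≠ 0) {x y z : K} (hx0 : x ≠ 0)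
    (htop : IntermediateField.adjoin k {x, y} = ⊤) (σ : K ≃ₐ[k] K) (hx : σ x = -x) (hz : σ z = z)
    (hzy : z = y ∨ z = y * x) :
    IsInvolutionFixing σ (IntermediateField.adjoin k {x ^ 2, z}) ∧
      Module.finrank (IntermediateField.adjoin k {x ^ 2, z}) K = 2 := by
  set M := IntermediateField.adjoin k {x ^ 2, z}
  have hfix : ∀ m ∈ M, σ m = m := fun m hm => by
    induction hm using IntermediateField.adjoin_induction with
    | mem m hm =>
      rcases hm with rfl | rfl
      · rw [map_pow, hx, neg_sq]
      · exact hz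
    | algebraMap c => exact σ.commutes c
    | add a b _ _ ha hb => rw [map_add, ha, hb]
    | inv a _ ha => rw [map_inv₀, ha]
    | mul a b _ _ ha hb => rw [map_mul, ha, hb]
  have hxM : x ∉ M := fun hmem => by
    have h1 := hfix x hmem
    rw [hx] at h1
    exact hx0 ((mul_eq_zero.1 (by linear_combination -h1 : 2 * x = 0)).resolve_left
      (two_ne_zero_of_algebra h2))
  have htop' : IntermediateField.adjoin k {x, z} = ⊤ := by
    rw [eq_top_iff, ← htop, IntermediateField.adjoin_le_iff]
    have hx' : x ∈ IntermediateField.adjoin k {x, z} :=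
      IntermediateField.subset_adjoin k _ (by simp)
    have hz' : z ∈ IntermediateField.adjoin k {x, z} :=
      IntermediateField.subset_adjoin k _ (by simp)
    rintro s (rfl | rfl)
    · exact hx'
    · rcases hzy with h | h
      · exact h ▸ hz'
      · have : s = z / x := by rw [h, mul_div_cancel_right₀ _ hx0]
        rw [this]
        exact div_mem hz' hx'
  have hgen : IsSqrtGenerator M x := by
    refine .of_adjoin hxM (IntermediateField.subset_adjoin k _ (by simp)) htop' ?_
    rintro s (rfl | rfl)
    · exact Or.inr rfl
    · exact Or.inl (IntermediateField.subset_adjoin k _ (by simp))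
  exact ⟨hgen.isInvolutionFixing h2 σ hfix hx, hgen.finrank_eq_two⟩

/-- The field of invariants of an involution fixing `x` is `k(x)`. -/
theorem IsSqrtModel.eq_adjoin_simple_of_fixed (h2 : (2 : k) ≠ 0) {x y : K} {f : k[X]}
    (h : IsSqrtModel x y f) {ζ : K ≃ₐ[k] K} {F : IntermediateField k K}
    (hF : IsInvolutionFixing ζ F) (hx : ζ x = x) : F = k⟮x⟯ := by
  have hxF : k⟮x⟯ ≤ F := by
    rw [IntermediateField.adjoin_simple_le_iff, hF.2, hx]
  have hsq : ζ y ^ 2 = y ^ 2 := by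
    rw [← map_pow]
    exact (hF.2 _).1 (hxF h.isSqrtGenerator.sq_mem)
  rcases sq_eq_sq_iff_eq_or_eq_neg.1 hsq with hy | hy
  · exfalso
    have htop : F = ⊤ := by
      rw [eq_top_iff, ← h.adjoin_eq_top, IntermediateField.adjoin_le_iff]
      rintro s (rfl | rfl)
      · rwa [SetLike.mem_coe, hF.2]
      · rwa [SetLike.mem_coe, hF.2]
    have h1 : ζ = 1 := by
      ext z
      exact (hF.2 z).1 (htop ▸ IntermediateField.mem_top)
    have h3 := hF.1
    rw [h1, orderOf_one] at h3
    omega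
  · exact eq_of_isInvolutionFixing hF
      (h.isSqrtGenerator.isInvolutionFixing h2 ζ (fun m hm => (hF.2 m).1 (hxF hm)) hy)

end Subfields
end HypSplit

theorem mainTheorem6 {k K : Type*} [Field k] [IsAlgClosed k] (h2 : (2 : k) ≠ 0)
    [Field K] [Algebra k K] (hK : HypSplit.IsHyperelliptic k K 3)
    (F : IntermediateField k K) (hF : HypSplit.IsElliptic k F)
    (hdeg : Module.finrank F K = 2) :
    ∃ (X Y : K) (a b c : k),
      -- the equation of `K = k(X, Y)`
      (IntermediateField.adjoin k {X, Y} = ⊤ ∧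
        Y ^ 2 = X ^ 8 + algebraMap k K a * X ^ 6 + algebraMap k K b * X ^ 4
          + algebraMap k K c * X ^ 2 + 1 ∧
        HypSplit.Δ a b c ≠ 0) ∧
      -- the elliptic subfield `F = k(U, V)`
      (∃ U V : K, U = X ^ 2 ∧ V = Y ∧
        F = IntermediateField.adjoin k {U, V} ∧
        V ^ 2 = U ^ 4 + algebraMap k K a * U ^ 3 + algebraMap k K b * U ^ 2
          + algebraMap k K c * U + 1) ∧
      -- the complementary genus 2 subfield `L = k(x, y)`
      (∃ (L : IntermediateField k K) (x y : K), x = X ^ 2 ∧ y = Y * X ∧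
        L = IntermediateField.adjoin k {x, y} ∧
        HypSplit.IsFunctionFieldOfGenus k L 2 ∧
        Module.finrank L K = 2 ∧
        HypSplit.IsComplementary F L ∧
        y ^ 2 = x * (x ^ 4 + algebraMap k K a * x ^ 3 + algebraMap k K b * x ^ 2
          + algebraMap k K c * x + 1)) := by
  obtain ⟨⟨-, hg⟩, -, x, hx, hxdeg⟩ := hK
  obtain ⟨w, hw⟩ := HypSplit.exists_isSqrtGenerator h2 hdeg
  obtain ⟨ζ₁, -, -, hζF⟩ := hw.exists_involution h2
  have hζζ : ∀ z, ζ₁ (ζ₁ z) = z := fun z => by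
    have h1 : ζ₁ ^ 2 = 1 := hζF.1 ▸ pow_orderOf_eq_one ζ₁
    rw [← AlgEquiv.mul_apply, ← pow_two, h1, AlgEquiv.one_apply]
  obtain ⟨y, f, hm⟩ := HypSplit.exists_isSqrtModel h2 hx hxdeg
  have hne : ζ₁ x ≠ x := fun h => by
    have h1 := hF.2
    rw [hm.eq_adjoin_simple_of_fixed h2 hζF h, HypSplit.genus_adjoin_simple h2 hx] at h1
    omega
  obtain ⟨p, q, hp0, hp, hq, hpq⟩ := hm.exists_moebius h2 hg (hm.map_algEquiv ζ₁)
  obtain ⟨x₁, hx₁, hζx₁⟩ := HypSplit.exists_negated_generator h2 hx ζ₁ hζζ hp0 hp hq hpq hne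
  have htr : Transcendental k x₁ := HypSplit.transcendental_of_mem_adjoin_simple hx
    (hx₁ ▸ IntermediateField.mem_adjoin_simple_self k x)
  obtain ⟨y₁, f₁, hm₁⟩ := HypSplit.exists_isSqrtModel h2 htr (hx₁ ▸ hxdeg)
  obtain ⟨X, Y, a, b, c, hm, hX, hY⟩ := hm₁.exists_normal_form h2 hg ζ₁ hζζ hζx₁
  have hY1 : ζ₁ Y = Y := by
    refine hY.resolve_right fun hY => ?_
    -- otherwise `F = k(X², Y X)`, which has genus two
    obtain ⟨hfix, -⟩ := HypSplit.isInvolutionFixing_adjoin_sq h2 hm.x_ne_zero hm.adjoin_eq_top ζ₁ hX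
      (z := Y * X) (by rw [map_mul, hX, hY, neg_mul_neg]) (Or.inr rfl)
    have h1 := (HypSplit.isFunctionFieldOfGenus_adjoin_sq_mul h2 hm).2
    rw [← HypSplit.eq_of_isInvolutionFixing hζF hfix, hF.2] at h1
    omega
  obtain ⟨hfixF, -⟩ := HypSplit.isInvolutionFixing_adjoin_sq h2 hm.x_ne_zero hm.adjoin_eq_top ζ₁ hX
    hY1 (Or.inl rfl)
  obtain ⟨ζ₀, hζ₀, hζ₀Y, hζ₀fix⟩ := hm.isSqrtGenerator.exists_involution h2
  have hζ₀X := hζ₀ X (IntermediateField.mem_adjoin_simple_self k X)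
  have hσX : (ζ₀ * ζ₁) X = -X := by rw [AlgEquiv.mul_apply, hX, map_neg, hζ₀X]
  have hσY : (ζ₀ * ζ₁) Y = -Y := by rw [AlgEquiv.mul_apply, hY1, hζ₀Y]
  obtain ⟨hfixL, hdegL⟩ := HypSplit.isInvolutionFixing_adjoin_sq h2 hm.x_ne_zero hm.adjoin_eq_top
    (ζ₀ * ζ₁) hσX (z := Y * X) (by rw [map_mul, hσX, hσY, neg_mul_neg]) (Or.inr rfl)
  have hsq : Y ^ 2 = X ^ 8 + algebraMap k K a * X ^ 6 + algebraMap k K b * X ^ 4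
      + algebraMap k K c * X ^ 2 + 1 := by
    rw [hm.sq_eq, Polynomial.expand_aeval, HypSplit.quartic]
    simp only [map_add, map_mul, map_pow, Polynomial.aeval_X, Polynomial.aeval_C, map_one]
    ring
  refine ⟨X, Y, a, b, c, ⟨hm.adjoin_eq_top, hsq,
    HypSplit.Δ_ne_zero_of_squarefree h2 (HypSplit.squarefree_of_expand hm.squarefree)⟩,
    ⟨X ^ 2, Y, rfl, rfl, HypSplit.eq_of_isInvolutionFixing hζF hfixF, ?_⟩,
    ⟨_, X ^ 2, Y * X, rfl, rfl, rfl, HypSplit.isFunctionFieldOfGenus_adjoin_sq_mul h2 hm, hdegL,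
      ⟨ζ₀, ζ₁, ⟨X, hm.transcendental, hζ₀fix⟩, hζF, hfixL⟩, ?_⟩⟩
  · rw [hsq]; ring
  · rw [mul_pow, hsq]; ring
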